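/- For an integer $g\ge 1$ let $I_g$ be the $g\times g$ identity matrix, $J=\begin{pmatrix}0&I_g\\-I_g&0\end{pmatrix}$, and $\mathrm{Sp}(2g,R)=\{M\in \mathrm{GL}(2g,R)\mid {}^tMJM=J\}$ for a commutative ring $R$. Let $$\mathrm{urSp}(2g)=\left\{\begin{pmatrix}A&B\\C&D\end{pmatrix}\in \mathrm{Sp}(2g,\mathbb Z)\ \middle|\ C=0\right\}$$ (with $g\times g$ blocks), and for $d\ge 2$ let $\mathrm{urSp}(2g)[d]$ be the kernel of the restriction to $\mathrm{urSp}(2g)$ of the reduction homomorphism $\mathrm{Sp}(2g,\mathbb Z)\to \mathrm{Sp}(2g,\mathbb Z/d\mathbb Z)$. For $1\le i,j\le g$ let $S_{i,j}$ be the $g\times g$ matrix whose $(i,j)$- and $(j,i)$-entries are $1$ and whose other entries are $0$ (so $S_{i,i}$ has a single nonzero entry, equal to $1$, at $(i,i)$). Let $F_i=I_g-2S_{i,i}$, and for $i\ne j$ let $E_{i,j}$ be the matrix obtained from $I_g$ by replacing its $(i,j)$-entry by $1$. Define the following elements of $\mathrm{urSp}(2g)$: $$X_{i,j}=\begin{pmatrix}E_{i,j}&0\\0&E_{j,i}^{-1}\end{pmatrix}\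 (i\ne j),\qquad Y_{i,j}=\begin{pmatrix}I_g&S_{i,j}\\0&I_g\end{pmatrix},\qquad Z_i=\begin{pmatrix}F_i&0\\0&F_i\end{pmatrix}.$$ A subgroup $N$ of a group $G$ is normally generated in $G$ by a subset $T\subseteq G$ if $N$ is the smallest normal subgroup of $G$ containing $T$. **Proposition.** (1) For every $g\ge 1$, $\mathrm{urSp}(2g)[2]$ is normally generated in $\mathrm{urSp}(2g)$ by $Y_{1,1}^2$ and $Z_1$. (2) For all $g\ge 3$ and $d\ge 3$, $\mathrm{urSp}(2g)[d]$ is normally generated in $\mathrm{urSp}(2g)$ by $X_{1,2}^d$ and $Y_{1,1}^d$. -/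

import Mathlib

open Matrix

namespace UrSp

/-- The standard skew form `(0, I; -I, 0)`, the negative of Mathlib's `Matrix.J`, gives the same
symplectic group `{M | ᵗM J M = J}`. -/
theorem mem_symplecticGroup_iff {g : ℕ} {R : Type*} [CommRing R]
    {M : Matrix (Fin g ⊕ Fin g) (Fin g ⊕ Fin g) R} :
    M ∈ symplecticGroup (Fin g) R ↔
      Mᵀ * fromBlocks 0 1 (-1) 0 * M = fromBlocks 0 1 (-1) 0 := by
  have h : (fromBlocks 0 1 (-1) 0 : Matrix (Fin g ⊕ Fin g) (Fin g ⊕ Fin g) R) =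
      -Matrix.J (Fin g) R := by
    simp [Matrix.J, fromBlocks_neg]
  rw [h, SymplecticGroup.mem_iff', Matrix.mul_neg, Matrix.neg_mul, neg_inj]

/-- The group `urSp(2g)` of integral symplectic matrices whose lower left block vanishes. -/
def urSp (g : ℕ) : Subgroup (symplecticGroup (Fin g) ℤ) where
  carrier := {M | (M : Matrix (Fin g ⊕ Fin g) (Fin g ⊕ Fin g) ℤ).toBlocks₂₁ = 0}
  one_mem' := by
    ext i j
    simp [toBlocks₂₁]
  mul_mem' := by
    intro a b ha hb
    have ha' : ∀ i j, (a : Matrix (Fin g ⊕ Fin g) (Fin g ⊕ Fin g) ℤ) (Sum.inr i) (Sum.inl j) = 0 :=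
      fun i j => congrFun (congrFun ha i) j
    have hb' : ∀ i j, (b : Matrix (Fin g ⊕ Fin g) (Fin g ⊕ Fin g) ℤ) (Sum.inr i) (Sum.inl j) = 0 :=
      fun i j => congrFun (congrFun hb i) j
    ext i j
    simp [toBlocks₂₁, Matrix.mul_apply, ha', hb']
  inv_mem' := by
    intro a ha
    have ha' : (a : Matrix (Fin g ⊕ Fin g) (Fin g ⊕ Fin g) ℤ).toBlocks₂₁ = 0 := ha
    change ((a⁻¹ : symplecticGroup (Fin g) ℤ) :
      Matrix (Fin g ⊕ Fin g) (Fin g ⊕ Fin g) ℤ).toBlocks₂₁ = 0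
    rw [SymplecticGroup.coe_inv,
      ← fromBlocks_toBlocks (a : Matrix (Fin g ⊕ Fin g) (Fin g ⊕ Fin g) ℤ), ha']
    simp [Matrix.J, fromBlocks_transpose, fromBlocks_neg, fromBlocks_multiply]

/-- Entrywise reduction modulo `d`, as a homomorphism `Sp(2g, ℤ) → Sp(2g, ℤ/d)`. -/
def reduction (g d : ℕ) : symplecticGroup (Fin g) ℤ →* symplecticGroup (Fin g) (ZMod d) where
  toFun M := ⟨(M : Matrix (Fin g ⊕ Fin g) (Fin g ⊕ Fin g) ℤ).map (Int.castRingHom (ZMod d)),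
    SymplecticGroup.map_mem M.2 (Int.castRingHom (ZMod d))⟩
  map_one' := Subtype.ext (map_one (Int.castRingHom (ZMod d)).mapMatrix)
  map_mul' M N := Subtype.ext (map_mul (Int.castRingHom (ZMod d)).mapMatrix M.1 N.1)

/-- The level `d` subgroup `urSp(2g)[d]`: the kernel of reduction modulo `d` on `urSp(2g)`. -/
def level (g d : ℕ) : Subgroup (urSp g) :=
  ((reduction g d).comp (urSp g).subtype).ker

/-- The element of `urSp(2g)` with blocks `(A, B; 0, D)`. -/
def ofBlocks {g : ℕ} (A B D : Matrix (Fin g) (Fin g) ℤ) (hAD : Aᵀ * D = 1)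
    (hBD : Bᵀ * D = Dᵀ * B) : urSp g :=
  ⟨⟨fromBlocks A B 0 D, SymplecticGroup.fromBlocks_mem_iff.2 ⟨by simp, hBD, by simpa using hAD⟩⟩,
    toBlocks_fromBlocks₂₁ A B 0 D⟩

/-- The elementary matrix `E_{i,j}`, with an extra `1` in the entry `(i, j)`. -/
def E {g : ℕ} (i j : Fin g) : Matrix (Fin g) (Fin g) ℤ := 1 + single i j 1

/-- The symmetric matrix `S_{i,j}`, with entries `1` at `(i, j)` and `(j, i)` and `0` elsewhere. -/
def S {g : ℕ} (i j : Fin g) : Matrix (Fin g) (Fin g) ℤ :=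
  if i = j then single i i 1 else single i j 1 + single j i 1

/-- The diagonal matrix `F_i`, with entry `-1` at `(i, i)` and `1` elsewhere on the diagonal. -/
def F {g : ℕ} (i : Fin g) : Matrix (Fin g) (Fin g) ℤ := 1 - (2 : ℤ) • S i i

theorem E_transpose {g : ℕ} (i j : Fin g) : (E i j)ᵀ = E j i := by
  simp [E, transpose_single]

theorem E_det {g : ℕ} {i j : Fin g} (hij : i ≠ j) : (E i j).det = 1 :=
  det_transvection_of_ne i j hij 1

theorem S_transpose {g : ℕ} (i j : Fin g) : (S i j)ᵀ = S i j := by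
  unfold S
  split_ifs <;> simp [transpose_single, add_comm]

theorem F_transpose {g : ℕ} (i : Fin g) : (F i)ᵀ = F i := by
  rw [F, transpose_sub, transpose_smul, S_transpose, transpose_one]

theorem F_mul_self {g : ℕ} (i : Fin g) : F i * F i = 1 := by
  have h : S i i * S i i = S i i := by simp [S]
  simp only [F, mul_sub, sub_mul, mul_one, one_mul, two_smul, mul_add, add_mul, h]
  abel

/-- `X_{i,j}`, with blocks `(E_{i,j}, 0; 0, E_{j,i}⁻¹)`, for `i ≠ j`. -/
noncomputable def X {g : ℕ} (i j : Fin g) (hij : i ≠ j) : urSp g :=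
  ofBlocks (E i j) 0 (E j i)⁻¹
    (by rw [E_transpose]; exact mul_nonsing_inv _ (by simp [E_det hij.symm])) (by simp)

/-- `Y_{i,j}`, with blocks `(I, S_{i,j}; 0, I)`. -/
def Y {g : ℕ} (i j : Fin g) : urSp g :=
  ofBlocks 1 (S i j) 1 (by simp) (by simp [S_transpose])

/-- `Z_i`, with blocks `(F_i, 0; 0, F_i)`. -/
def Z {g : ℕ} (i : Fin g) : urSp g :=
  ofBlocks (F i) 0 (F i) (by rw [F_transpose, F_mul_self]) (by simp)

end UrSp

/-! An element of urSp(2g) factors as a block diagonal matrix diag(A, ᵗA⁻¹) times a unipotent one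
with symmetric upper right block B. At level d both factors have level d, and `level_le` treats them
separately.

Unipotent factor: conjugation by diag(U, ᵗU⁻¹) acts by B ↦ U B ᵗU. It carries d S₁₁ to d v ᵗv for v
= U e₁; polarization then gives every d S_{i,j} (`smul_S_mem_upperPart`), and these span the
symmetric matrices divisible by d.

Diagonal factor: a normal subgroup N of GL_g(ℤ) has to contain the whole congruence subgroup of
level q = d. Row and column operations of level q split off one coordinate at a time, so it suffices
to treat SL₂ blocks (`mem_of_isCongrOne`). For q = 2, blocks are products of level 2 transvections
and sign matrices, by a Euclidean algorithm with even quotients (`block_mem_of_level_two`), in any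
size. For q ≥ 3 and g ≥ 3 the argument is Mennicke's: modulo N, the class of a block depends only on
its first row (a, b). This symbol is multiplicative in a and invariant under a ↦ a + tb, b ↦ b + qta
and b ↦ -b. Dirichlet's theorem and quadratic reciprocity produce two coprime exponents that kill it
(`IsSymbol.eq_one`). -/

namespace UrSp

/-! ### Transvections in SL₃(ℤ) and the Mennicke symbol. -/

/-- The integral transvection `1 + t e_{i,j}` in `SL₃`. -/
def elem (i j : Fin 3) (hij : i ≠ j) (t : ℤ) : Matrix.SpecialLinearGroup (Fin 3) ℤ :=
  ⟨1 + single i j t, det_transvection_of_ne i j hij t⟩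

/-- The element of `SL₃(ℤ)` with upper left block `(a, b; c, d)`. -/
def corner (a b c d : ℤ) (h : a * d - b * c = 1) : Matrix.SpecialLinearGroup (Fin 3) ℤ :=
  ⟨!![a, b, 0; c, d, 0; 0, 0, 1], by rw [det_fin_three]; simp; linarith⟩

theorem coe_corner {a b c d : ℤ} (h : a * d - b * c = 1) :
    (corner a b c d h : Matrix (Fin 3) (Fin 3) ℤ) = !![a, b, 0; c, d, 0; 0, 0, 1] := rfl

theorem coe_elem {i j : Fin 3} (hij : i ≠ j) (t : ℤ) :
    (elem i j hij t : Matrix (Fin 3) (Fin 3) ℤ) = 1 + single i j t := rfl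

theorem coe_injective {n : Type*} [DecidableEq n] [Fintype n] {A B : Matrix.SpecialLinearGroup n ℤ}
    (h : (A : Matrix n n ℤ) = B) : A = B := Subtype.ext h

def e12 (t : ℤ) := elem 0 1 (by decide) t
def e13 (t : ℤ) := elem 0 2 (by decide) t
def e21 (t : ℤ) := elem 1 0 (by decide) t
def e23 (t : ℤ) := elem 1 2 (by decide) t
def e31 (t : ℤ) := elem 2 0 (by decide) t
def e32 (t : ℤ) := elem 2 1 (by decide) t

theorem coe_e12 (t : ℤ) : (e12 t : Matrix (Fin 3) (Fin 3) ℤ) = !![1, t, 0; 0, 1, 0; 0, 0, 1] := by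
  ext i j; fin_cases i <;> fin_cases j <;> simp [e12, coe_elem, single]
theorem coe_e13 (t : ℤ) : (e13 t : Matrix (Fin 3) (Fin 3) ℤ) = !![1, 0, t; 0, 1, 0; 0, 0, 1] := by
  ext i j; fin_cases i <;> fin_cases j <;> simp [e13, coe_elem, single]
theorem coe_e21 (t : ℤ) : (e21 t : Matrix (Fin 3) (Fin 3) ℤ) = !![1, 0, 0; t, 1, 0; 0, 0, 1] := by
  ext i j; fin_cases i <;> fin_cases j <;> simp [e21, coe_elem, single]
theorem coe_e23 (t : ℤ) : (e23 t : Matrix (Fin 3) (Fin 3) ℤ) = !![1, 0, 0; 0, 1, t; 0, 0, 1] := by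
  ext i j; fin_cases i <;> fin_cases j <;> simp [e23, coe_elem, single]
theorem coe_e31 (t : ℤ) : (e31 t : Matrix (Fin 3) (Fin 3) ℤ) = !![1, 0, 0; 0, 1, 0; t, 0, 1] := by
  ext i j; fin_cases i <;> fin_cases j <;> simp [e31, coe_elem, single]
theorem coe_e32 (t : ℤ) : (e32 t : Matrix (Fin 3) (Fin 3) ℤ) = !![1, 0, 0; 0, 1, 0; 0, t, 1] := by
  ext i j; fin_cases i <;> fin_cases j <;> simp [e32, coe_elem, single]

theorem elem_add {i j : Fin 3} (hij : i ≠ j) (s t : ℤ) :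
    elem i j hij (s + t) = elem i j hij s * elem i j hij t := by
  apply coe_injective
  rw [Matrix.SpecialLinearGroup.coe_mul, coe_elem, coe_elem, coe_elem]
  simp [mul_add, add_mul, single_add, hij.symm, add_assoc, add_left_comm]

section Symbol

variable {Q : Type*} [Group Q] {q : ℤ} {f : Matrix.SpecialLinearGroup (Fin 3) ℤ →* Q}

theorem map_elem_congr (hf : ∀ i j hij t, f (elem i j hij (q * t)) = 1) {i j : Fin 3} (hij : i ≠ j)
    {s t : ℤ} (h : q ∣ s - t) : f (elem i j hij s) = f (elem i j hij t) := by
  obtain ⟨k, hk⟩ := h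
  rw [show s = q * k + t by linarith, elem_add, map_mul, hf, one_mul]

theorem map_elem_eq_one (hf : ∀ i j hij t, f (elem i j hij (q * t)) = 1) {i j : Fin 3} (hij : i ≠ j)
    {s : ℤ} (h : q ∣ s) : f (elem i j hij s) = 1 := by
  obtain ⟨k, rfl⟩ := h
  exact hf i j hij k

/-- A commutator of transvections that involve the third coordinate; with `e21_eq` it extends
commutation from those to all transvections. -/
theorem e12_eq (t : ℤ) : e12 t = e13 t * e32 1 * e13 (-t) * e32 (-1) := by
  apply coe_injective
  simp only [Matrix.SpecialLinearGroup.coe_mul, coe_e12, coe_e13, coe_e32, Matrix.mul_fin_three]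
  simp

theorem e21_eq (t : ℤ) : e21 t = e23 t * e31 1 * e23 (-t) * e31 (-1) := by
  apply coe_injective
  simp only [Matrix.SpecialLinearGroup.coe_mul, coe_e21, coe_e23, coe_e31, Matrix.mul_fin_three]
  simp

/-- Conjugation by the corner acts on the third column, and on the third row, through a 2 × 2 matrix
congruent to 1 modulo `q`. So it changes `e13`, `e23`, `e31`, `e32` only by level `q` transvections,
which `f` kills; `e12` and `e21` are commutators of these. -/
theorem commute_corner (hf : ∀ i j hij t, f (elem i j hij (q * t)) = 1) {a b c d : ℤ}
    (h : a * d - b * c = 1) (ha : q ∣ a - 1) (hb : q ∣ b) (hc : q ∣ c) (hd : q ∣ d - 1) (t : ℤ) :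
    Commute (f (corner a b c d h)) (f (e12 t)) ∧ Commute (f (corner a b c d h)) (f (e13 t)) ∧
    Commute (f (corner a b c d h)) (f (e21 t)) ∧ Commute (f (corner a b c d h)) (f (e23 t)) ∧
    Commute (f (corner a b c d h)) (f (e31 t)) ∧ Commute (f (corner a b c d h)) (f (e32 t)) := by
  have h13 (t) : Commute (f (corner a b c d h)) (f (e13 t)) := by
    have : corner a b c d h * e13 t = e13 (a * t) * e23 (c * t) * corner a b c d h := by
      apply coe_injective
      simp only [Matrix.SpecialLinearGroup.coe_mul, coe_e13, coe_e23, coe_corner, Matrix.mul_fin_three]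
      simp
    have := congrArg f this
    rw [map_mul, map_mul, map_mul, e23, map_elem_eq_one hf _ (hc.mul_right t), show f (e13 _) = f (e13 t) from
      map_elem_congr hf _ (s := a * t) (t := t) ⟨(a - 1) / q * t, by
        rw [← mul_assoc, Int.mul_ediv_cancel' ha]; ring⟩, mul_one] at this
    exact this
  have h23 (t) : Commute (f (corner a b c d h)) (f (e23 t)) := by
    have : corner a b c d h * e23 t = e13 (b * t) * e23 (d * t) * corner a b c d h := by
      apply coe_injective
      simp only [Matrix.SpecialLinearGroup.coe_mul, coe_e13, coe_e23, coe_corner, Matrix.mul_fin_three]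
      simp
    have := congrArg f this
    rw [map_mul, map_mul, map_mul, e13, map_elem_eq_one hf _ (hb.mul_right t), show f (e23 _) = f (e23 t) from
      map_elem_congr hf _ (s := d * t) (t := t) ⟨(d - 1) / q * t, by
        rw [← mul_assoc, Int.mul_ediv_cancel' hd]; ring⟩, one_mul] at this
    exact this
  have h31 (t) : Commute (f (corner a b c d h)) (f (e31 t)) := by
    have : e31 t * corner a b c d h = corner a b c d h * (e31 (a * t) * e32 (b * t)) := by
      apply coe_injective
      simp only [Matrix.SpecialLinearGroup.coe_mul, coe_e31, coe_e32, coe_corner, Matrix.mul_fin_three]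
      simp [mul_comm]
    have := congrArg f this
    rw [map_mul, map_mul, map_mul, e32, map_elem_eq_one hf _ (hb.mul_right t), show f (e31 _) = f (e31 t) from
      map_elem_congr hf _ (s := a * t) (t := t) ⟨(a - 1) / q * t, by
        rw [← mul_assoc, Int.mul_ediv_cancel' ha]; ring⟩, mul_one] at this
    exact this.symm
  have h32 (t) : Commute (f (corner a b c d h)) (f (e32 t)) := by
    have : e32 t * corner a b c d h = corner a b c d h * (e31 (c * t) * e32 (d * t)) := by
      apply coe_injective
      simp only [Matrix.SpecialLinearGroup.coe_mul, coe_e31, coe_e32, coe_corner, Matrix.mul_fin_three]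
      simp [mul_comm]
    have := congrArg f this
    rw [map_mul, map_mul, map_mul, e31, map_elem_eq_one hf _ (hc.mul_right t), show f (e32 _) = f (e32 t) from
      map_elem_congr hf _ (s := d * t) (t := t) ⟨(d - 1) / q * t, by
        rw [← mul_assoc, Int.mul_ediv_cancel' hd]; ring⟩, one_mul] at this
    exact this.symm
  refine ⟨?_, h13 t, ?_, h23 t, h31 t, h32 t⟩
  · rw [e12_eq]
    simp only [map_mul]
    exact (((h13 _).mul_right (h32 _)).mul_right (h13 _)).mul_right (h32 _)
  · rw [e21_eq]
    simp only [map_mul]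
    exact (((h23 _).mul_right (h31 _)).mul_right (h23 _)).mul_right (h31 _)

/-- `x` is the value at `(a, b)` of the Mennicke symbol attached to `f`. -/
def IsSymbol (q : ℤ) (f : Matrix.SpecialLinearGroup (Fin 3) ℤ →* Q) (a b : ℤ) (x : Q) : Prop :=
  ∃ (c d : ℤ) (h : a * d - b * c = 1), q ∣ a - 1 ∧ q ∣ b ∧ q ∣ c ∧ q ∣ d - 1 ∧
    f (corner a b c d h) = x

namespace IsSymbol

variable {a b : ℤ} {x y : Q}

theorem isCoprime (hx : IsSymbol q f a b x) : IsCoprime a b := by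
  obtain ⟨c, d, h, -⟩ := hx
  exact ⟨d, -c, by linarith⟩

theorem dvd_left (hx : IsSymbol q f a b x) : q ∣ a - 1 := hx.choose_spec.choose_spec.choose_spec.1

theorem dvd_right (hx : IsSymbol q f a b x) : q ∣ b := hx.choose_spec.choose_spec.choose_spec.2.1

/-- Two completions of the same first row differ by a left factor `e21`, whose parameter is
divisible by `q`. -/
theorem unique (hf : ∀ i j hij t, f (elem i j hij (q * t)) = 1) (hx : IsSymbol q f a b x)
    (hy : IsSymbol q f a b y) : x = y := by
  obtain ⟨c, d, h, ha, hb, hc, hd, rfl⟩ := hx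
  obtain ⟨c', d', h', -, -, hc', hd', rfl⟩ := hy
  have : corner a b c' d' h' = e21 (c' * d - d' * c) * corner a b c d h := by
    apply coe_injective
    simp only [Matrix.SpecialLinearGroup.coe_mul, coe_e21, coe_corner, Matrix.mul_fin_three]
    ext i j
    fin_cases i <;> fin_cases j <;> simp
    · linear_combination (-c') * h + c * h'
    · linear_combination (-d') * h + d * h'
  rw [this, map_mul, e21, map_elem_eq_one hf, one_mul]
  exact (hc'.mul_right _).sub (hc.mul_left _)

/-- The new corner is the conjugate of the old one by `e21 t`. As `t` need not be divisible by `q`,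
multiplication alone would not do; conjugation is harmless by `commute_corner`. -/
theorem add_mul_left (hf : ∀ i j hij t, f (elem i j hij (q * t)) = 1) (hx : IsSymbol q f a b x)
    (t : ℤ) : IsSymbol q f (a + t * b) b x := by
  obtain ⟨c, d, h, ha, hb, hc, hd, rfl⟩ := hx
  refine ⟨c + t * d - t * (a + t * b), d - t * b, by linear_combination h, ?_, hb, ?_, ?_, ?_⟩
  · rw [add_sub_right_comm]; exact ha.add (hb.mul_left _)
  · rw [show c + t * d - t * (a + t * b) = c + t * (d - 1) - t * (a - 1) - t * t * b by ring]
    exact ((hc.add (hd.mul_left _)).sub (ha.mul_left _)).sub (hb.mul_left _)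
  · rw [sub_right_comm]; exact hd.sub (hb.mul_left _)
  · have key : e21 t * corner (a + t * b) b (c + t * d - t * (a + t * b)) (d - t * b)
        (by linear_combination h) = corner a b c d h * e21 t := by
      apply coe_injective
      simp only [Matrix.SpecialLinearGroup.coe_mul, coe_e21, coe_corner, Matrix.mul_fin_three]
      ext i j
      fin_cases i <;> fin_cases j <;> simp <;> ring
    have := congrArg f key
    rw [map_mul, map_mul, (commute_corner hf h ha hb hc hd t).2.2.1.eq] at this
    exact mul_left_cancel this

theorem add_mul_right (hf : ∀ i j hij t, f (elem i j hij (q * t)) = 1) (hx : IsSymbol q f a b x)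
    (t : ℤ) : IsSymbol q f a (b + q * t * a) x := by
  obtain ⟨c, d, h, ha, hb, hc, hd, rfl⟩ := hx
  refine ⟨c, d + q * t * c, by linear_combination h, ha, ?_, hc, ?_, ?_⟩
  · rw [mul_assoc]; exact hb.add (dvd_mul_right _ _)
  · rw [add_sub_right_comm]; exact hd.add (hc.mul_left _)
  · have key : corner a (b + q * t * a) c (d + q * t * c) (by linear_combination h) =
        corner a b c d h * e12 (q * t) := by
      apply coe_injective
      simp only [Matrix.SpecialLinearGroup.coe_mul, coe_e12, coe_corner, Matrix.mul_fin_three]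
      ext i j
      fin_cases i <;> fin_cases j <;> simp <;> ring
    rw [key, map_mul, e12, hf, mul_one]

/-- Conjugation by diag(-1, 1, -1), the square of a Weyl element written in `e13` and `e31`; its
image commutes with that of the corner. -/
theorem neg_right (hf : ∀ i j hij t, f (elem i j hij (q * t)) = 1) (hx : IsSymbol q f a b x) :
    IsSymbol q f a (-b) x := by
  obtain ⟨c, d, h, ha, hb, hc, hd, rfl⟩ := hx
  refine ⟨-c, d, by linear_combination h, ha, hb.neg_right, hc.neg_right, hd, ?_⟩
  have key : (e13 1 * e31 (-1) * e13 1) * (e13 1 * e31 (-1) * e13 1) *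
      corner a (-b) (-c) d (by linear_combination h) =
      corner a b c d h * ((e13 1 * e31 (-1) * e13 1) * (e13 1 * e31 (-1) * e13 1)) := by
    apply coe_injective
    simp only [Matrix.SpecialLinearGroup.coe_mul, coe_e13, coe_e31, coe_corner, Matrix.mul_fin_three]
    simp
  have h13 := (commute_corner hf h ha hb hc hd 1).2.1
  have h31 := (commute_corner hf h ha hb hc hd (-1)).2.2.2.2.1
  have hw := (h13.mul_right h31).mul_right h13
  have := congrArg f key
  simp only [map_mul] at this
  rw [(hw.mul_right hw).eq] at this
  exact mul_left_cancel this

/-- The third coordinate gives room: `u` is a quarter turn of the last two coordinates, and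
transvections bring the product of the corners, with `u` in between, back to a corner with first row
(a₁a₂, b). Modulo `q` the transvections have parameters ±1 or 0, so under `f` they cancel through
the relations `hu₁` and `hu₂`. -/
theorem mul {a₁ a₂ : ℤ} (hf : ∀ i j hij t, f (elem i j hij (q * t)) = 1)
    (hx : IsSymbol q f a₁ b x) (hy : IsSymbol q f a₂ b y) : IsSymbol q f (a₁ * a₂) b (x * y) := by
  obtain ⟨c₁, d₁, h₁, ha₁, hb, hc₁, hd₁, rfl⟩ := hx
  obtain ⟨c₂, d₂, h₂, ha₂, -, hc₂, hd₂, rfl⟩ := hy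
  have h₃ : a₁ * a₂ * (d₁ * d₂) - b * (c₂ + d₂ * c₁ * a₂) = 1 := by
    linear_combination a₂ * d₂ * h₁ + h₂
  have ha₃ : q ∣ a₁ * a₂ - 1 := by
    rw [show a₁ * a₂ - 1 = (a₁ - 1) * a₂ + (a₂ - 1) by ring]
    exact (ha₁.mul_right _).add ha₂
  have hd₃ : q ∣ d₁ * d₂ - 1 := by
    rw [show d₁ * d₂ - 1 = (d₁ - 1) * d₂ + (d₂ - 1) by ring]
    exact (hd₁.mul_right _).add hd₂
  have hc₃ : q ∣ c₂ + d₂ * c₁ * a₂ := hc₂.add ((hc₁.mul_left _).mul_right _)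
  refine ⟨_, _, h₃, ha₃, hb, hc₃, hd₃, ?_⟩
  set u := e32 1 * e23 (-1) * e32 1 with hu
  have key : e32 d₂ * corner a₁ b c₁ d₁ h₁ * (u * corner a₂ b c₂ d₂ h₂) =
      u * corner _ _ _ _ h₃ * e32 (-d₁) * e31 (-(c₁ * a₂)) * e23 a₁ * u := by
    apply coe_injective
    simp only [hu, Matrix.SpecialLinearGroup.coe_mul, coe_e23, coe_e31, coe_e32, coe_corner,
      Matrix.mul_fin_three]
    ext i j
    fin_cases i <;> fin_cases j <;> simp
    · ring
    · linear_combination -h₁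
    · ring
    · linear_combination (-d₂) * h₁
    · ring
  have hu₁ : e32 (-1) * e23 1 * u = e23 (-1) := by
    apply coe_injective
    simp only [hu, Matrix.SpecialLinearGroup.coe_mul, coe_e23, coe_e32, Matrix.mul_fin_three]
    simp
  have hu₂ : e32 1 * u = u * e23 (-1) := by
    apply coe_injective
    simp only [hu, Matrix.SpecialLinearGroup.coe_mul, coe_e23, coe_e32, Matrix.mul_fin_three]
    simp
  have hC {a c d : ℤ} (h : a * d - b * c = 1) (ha : q ∣ a - 1) (hc : q ∣ c) (hd : q ∣ d - 1) :
      Commute (f (corner a b c d h)) (f u) ∧ Commute (f (corner a b c d h)) (f (e23 (-1))) := by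
    have h32 := (commute_corner hf h ha hb hc hd 1).2.2.2.2.2
    have h23 := (commute_corner hf h ha hb hc hd (-1)).2.2.2.1
    refine ⟨?_, h23⟩
    rw [hu, map_mul, map_mul]
    exact (h32.mul_right h23).mul_right h32
  have := congrArg f key
  have hu₁ := congrArg f hu₁
  have hu₂ := congrArg f hu₂
  simp only [map_mul] at this hu₁ hu₂
  rw [show f (e32 d₂) = f (e32 1) from map_elem_congr hf _ hd₂,
    show f (e32 (-d₁)) = f (e32 (-1)) from map_elem_congr hf _ (by
      rw [show -d₁ - -1 = -(d₁ - 1) by ring]; exact hd₁.neg_right),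
    show f (e31 _) = 1 from map_elem_eq_one hf _ (hc₁.mul_right _).neg_right,
    show f (e23 a₁) = f (e23 1) from map_elem_congr hf _ ha₁, mul_one] at this
  have h1 := (hC h₁ ha₁ hc₁ hd₁).1.eq
  have h3 := (hC h₃ ha₃ hc₃ hd₃).2.eq
  generalize f (corner a₁ b c₁ d₁ h₁) = m₁ at *
  generalize f (corner a₂ b c₂ d₂ h₂) = m₂ at *
  generalize f (corner _ _ _ _ h₃) = m₃ at *
  refine (mul_left_cancel (a := f (e32 1) * f u) ?_).symm
  calc f (e32 1) * f u * (m₁ * m₂) = f (e32 1) * (f u * m₁) * m₂ := by simp only [mul_assoc]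
    _ = f u * m₃ * (f (e32 (-1)) * f (e23 1) * f u) := by
      rw [← h1]; simpa only [mul_assoc] using this
    _ = f (e32 1) * f u * m₃ := by rw [hu₁, mul_assoc, h3, hu₂, mul_assoc]

theorem one (hf : ∀ i j hij t, f (elem i j hij (q * t)) = 1) (hb : q ∣ b) :
    IsSymbol q f 1 b 1 := by
  refine ⟨0, 1, by simp, by simp, hb, by simp, by simp, ?_⟩
  obtain ⟨k, rfl⟩ := hb
  rw [← hf 0 1 (by decide) k]
  congr 1
  apply coe_injective
  exact (coe_e12 _).symm

theorem one_left (hf : ∀ i j hij t, f (elem i j hij (q * t)) = 1) (hx : IsSymbol q f 1 b x) :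
    x = 1 :=
  hx.unique hf (one hf hx.dvd_right)

theorem pow (hf : ∀ i j hij t, f (elem i j hij (q * t)) = 1) (hx : IsSymbol q f a b x) (n : ℕ) :
    IsSymbol q f (a ^ n) b (x ^ n) := by
  induction n with
  | zero => rw [pow_zero, pow_zero]; exact one hf hx.dvd_right
  | succ n ih => rw [pow_succ, pow_succ]; exact ih.mul hf hx

/-- If `a ≡ 1` modulo `b` then the symbol is trivial. -/
theorem eq_one_of_dvd (hf : ∀ i j hij t, f (elem i j hij (q * t)) = 1) (hx : IsSymbol q f a b x)
    (h : b ∣ a - 1) : x = 1 := by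
  obtain ⟨k, hk⟩ := h
  refine one_left hf (b := b) ?_
  have := hx.add_mul_left hf (-k)
  rwa [show a + -k * b = 1 by linarith] at this

end IsSymbol

end Symbol

end UrSp

/-! ### Vanishing of the Mennicke symbol. -/

namespace UrSp

variable {Q : Type*} [Group Q] {q : ℤ} {f : Matrix.SpecialLinearGroup (Fin 3) ℤ →* Q}

theorem eq_one_of_pow_of_coprime {x : Q} {m n : ℕ} (hm : x ^ m = 1) (hn : x ^ n = 1)
    (h : m.Coprime n) : x = 1 := by
  rw [← orderOf_eq_one_iff, ← Nat.dvd_one, ← h]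
  exact Nat.dvd_gcd (orderOf_dvd_of_pow_eq_one hm) (orderOf_dvd_of_pow_eq_one hn)

namespace IsSymbol

variable {a b : ℤ} {x : Q}

/-- If 4 ∣ q, then a ≡ 1 modulo 4 already. Otherwise make a odd, then use b ↦ b + qa to get 4 ∤ b;
now some a + tb is 1 modulo 4. -/
theorem exists_mod_four (hf : ∀ i j hij t, f (elem i j hij (q * t)) = 1) (hq : q ≠ 0)
    (hx : IsSymbol q f a b x) :
    ∃ a' b', b' ≠ 0 ∧ a' % 4 = 1 ∧ IsSymbol q f a' b' x := by
  have odd_of : ∀ {a b : ℤ}, IsSymbol q f a b x → a % 2 = 1 ∨ b % 2 = 1 := by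
    intro a b h
    obtain ⟨u, v, huv⟩ := h.isCoprime
    by_contra! hc
    obtain ⟨k, hk⟩ : (2 : ℤ) ∣ a := by omega
    obtain ⟨l, hl⟩ : (2 : ℤ) ∣ b := by omega
    have : 2 * (u * k + v * l) = 1 := by rw [← huv, hk, hl]; ring
    omega
  have step : ∀ {a b : ℤ}, b ≠ 0 → a % 2 = 1 → b % 4 ≠ 0 → IsSymbol q f a b x →
      ∃ a' b', b' ≠ 0 ∧ a' % 4 = 1 ∧ IsSymbol q f a' b' x := by
    intro a b hb ha hb4 h
    have : (a + 0 * b) % 4 = 1 ∨ (a + 1 * b) % 4 = 1 ∨ (a + 2 * b) % 4 = 1 ∨ (a + 3 * b) % 4 = 1 := by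
      omega
    rcases this with h' | h' | h' | h' <;> exact ⟨_, b, hb, h', h.add_mul_left hf _⟩
  by_cases h4 : (4 : ℤ) ∣ q
  · have ha : a % 4 = 1 := by have := h4.trans hx.dvd_left; omega
    by_cases hb : b = 0
    · refine ⟨a, _, ?_, ha, hx.add_mul_right hf 1⟩
      have : a ≠ 0 := by omega
      simp [hb, hq, this]
    · exact ⟨a, b, hb, ha, hx⟩
  have hodd : ∃ a', a' % 2 = 1 ∧ IsSymbol q f a' b x := by
    rcases Int.emod_two_eq_zero_or_one a with h | h
    · have := odd_of hx
      exact ⟨a + 1 * b, by omega, hx.add_mul_left hf 1⟩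
    · exact ⟨a, h, hx⟩
  obtain ⟨a', ha', h'⟩ := hodd
  by_cases hb : b % 4 = 0
  · have h4' : (b + q * 1 * a') % 4 ≠ 0 := by
      intro h0
      have h1 : (4 : ℤ) ∣ q * a' := by
        rw [mul_one] at h0
        omega
      refine h4 (IsCoprime.dvd_of_dvd_mul_right ?_ h1)
      rw [show (4 : ℤ) = 2 * 2 by norm_num]
      have : IsCoprime (2 : ℤ) a' := ⟨-(a' / 2), 1, by omega⟩
      exact this.mul_left this
    exact step (fun h0 => h4' (by rw [h0]; rfl)) ha' h4' (h'.add_mul_right hf 1)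
  · exact step (fun h0 => hb (by rw [h0]; rfl)) ha' hb h'

/-- Dirichlet's theorem for the class of -a modulo 4|b|: the factor 4 forces p ≡ 3, and -p ≡ a
modulo b allows replacing a by -p. -/
theorem exists_prime (hf : ∀ i j hij t, f (elem i j hij (q * t)) = 1) (hq : q ≠ 0)
    (hx : IsSymbol q f a b x) :
    ∃ (p : ℕ) (b' : ℤ), p.Prime ∧ p % 4 = 3 ∧ IsSymbol q f (-p) (q * b') x := by
  obtain ⟨a, b, hb, ha, hx⟩ := hx.exists_mod_four hf hq
  obtain ⟨b', rfl⟩ := hx.dvd_right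
  have hcop : IsCoprime (-a) ((4 * (q * b').natAbs : ℕ) : ℤ) := by
    push_cast
    refine IsCoprime.neg_left (IsCoprime.mul_right ?_ ?_)
    · exact ⟨1, -(a / 4), by omega⟩
    · rcases abs_choice (q * b') with h | h <;> rw [h]
      exacts [hx.isCoprime, hx.isCoprime.neg_right]
  obtain ⟨p, -, hp, hpa⟩ := Nat.forall_exists_prime_gt_and_zmodEq 0 (by simpa using hb) hcop
  obtain ⟨k, hk⟩ := (Int.modEq_iff_dvd.1 hpa)
  refine ⟨p, b', hp, ?_, ?_⟩
  · push_cast at hk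
    rw [mul_assoc] at hk
    omega
  · obtain ⟨e, he⟩ : (q * b') ∣ a + p := by
      have : (q * b') ∣ ((4 * (q * b').natAbs : ℕ) : ℤ) := by
        push_cast
        exact ((dvd_abs _ _).2 dvd_rfl).mul_left _
      have := (this.mul_right k)
      rw [← hk] at this
      rw [← dvd_neg]
      convert this using 1; ring
    have := hx.add_mul_left hf (-e)
    rwa [show a + -e * (q * b') = -p by linarith] at this

/-- Primes in a residue class modulo a prime `p` and a residue class modulo a coprime `n`. -/
theorem _root_.UrSp.exists_prime_gt_and_modEq (N : ℕ) {p n : ℕ} (hpn : p.Coprime n) (hp : p ≠ 0)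
    (hn : n ≠ 0) {r s : ℤ} (hr : IsCoprime r p) (hs : IsCoprime s n) :
    ∃ l > N, l.Prime ∧ (p : ℤ) ∣ r - l ∧ (n : ℤ) ∣ s - l := by
  obtain ⟨u, v, huv⟩ := Nat.isCoprime_iff_coprime.2 hpn
  have h1 : (p : ℤ) ∣ (r * (v * n) + s * (u * p)) - r :=
    ⟨(s - r) * u, by linear_combination r * huv⟩
  have h2 : (n : ℤ) ∣ (r * (v * n) + s * (u * p)) - s :=
    ⟨(r - s) * v, by linear_combination s * huv⟩
  have hc : IsCoprime (r * (v * n) + s * (u * p)) ((p * n : ℕ) : ℤ) := by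
    push_cast
    obtain ⟨k, hk⟩ := h1
    obtain ⟨m, hm⟩ := h2
    refine IsCoprime.mul_right ?_ ?_
    · rw [show r * (v * n) + s * (u * p) = r + p * k by linarith]
      exact hr.add_mul_left_left k
    · rw [show r * (v * n) + s * (u * p) = s + n * m by linarith]
      exact hs.add_mul_left_left m
  obtain ⟨l, hl, hlp, hmod⟩ := Nat.forall_exists_prime_gt_and_zmodEq N (mul_ne_zero hp hn) hc
  have := Int.modEq_iff_dvd.1 hmod
  push_cast at this
  refine ⟨l, hl, hlp, ?_, ?_⟩
  · have := (dvd_of_mul_right_dvd this).sub h1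
    rwa [show ∀ z w t : ℤ, z - w - (z - t) = t - w by intros; ring] at this
  · have := (dvd_of_mul_left_dvd this).sub h2
    rwa [show ∀ z w t : ℤ, z - w - (z - t) = t - w by intros; ring] at this

/-- Modifying `b` to `q l` with `l` a large prime, a power of the symbol with `a ^ n ≡ 1` modulo
`l` is trivial. -/
theorem pow_eq_one (hf : ∀ i j hij t, f (elem i j hij (q * t)) = 1) (hq : q ≠ 0) {l n : ℕ}
    (hl : l.Prime) (hlq : q.natAbs < l) (hx : IsSymbol q f a (q * l) x)
    (hn : (l : ℤ) ∣ a ^ n - 1) : x ^ n = 1 := by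
  -- Being a prime larger than |q|, `l` is coprime to `q`; so `q * l` divides `a ^ n - 1` as soon as
  -- both factors do.
  refine (hx.pow hf n).eq_one_of_dvd hf (IsCoprime.mul_dvd ?_ ?_ hn)
  · rw [Int.isCoprime_iff_gcd_eq_one, Int.gcd_comm]
    refine (Nat.Prime.coprime_iff_not_dvd hl).2 fun h => ?_
    have := Nat.le_of_dvd (Int.natAbs_pos.2 hq) h
    omega
  · exact (hx.pow hf n).dvd_left

/-- With a = -p and p ≡ 3 modulo 4, the second entry q b matters only through b modulo p, so b may
be taken to be a suitable prime. Since -1 is a nonresidue modulo p, one of b, -b is a square, and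
the sign is free. Two choices of the prime give coprime exponents that annihilate the symbol. -/
theorem eq_one (hf : ∀ i j hij t, f (elem i j hij (q * t)) = 1) (hq : q ≠ 0)
    (hx : IsSymbol q f a b x) : x = 1 := by
  obtain ⟨p, b, hp, hp4, hx⟩ := hx.exists_prime hf hq
  have := Fact.mk hp
  have move : ∀ {c : ℤ}, (p : ℤ) ∣ c - b → IsSymbol q f (-p) (q * c) x := by
    rintro c ⟨k, hk⟩
    have := hx.add_mul_right hf (-k)
    rwa [show q * b + q * -k * -p = q * c by linear_combination (-q) * hk] at this
  have hpb : IsCoprime b p := by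
    have := hx.isCoprime.symm.neg_right
    rw [neg_neg] at this
    exact this.of_mul_left_right
  -- reduce to the case where `b` is a square modulo `p`
  wlog hsq : legendreSym p b = 1 generalizing b with H
  · refine H (-b) (by simpa using hx.neg_right hf) ?_ hpb.neg_left ?_
    · intro c hc
      have := (move (c := -c) (by
        rw [show -c - b = -(c - -b) by ring]; exact hc.neg_right)).neg_right hf
      simpa using this
    · have hb0 : (b : ZMod p) ≠ 0 := by
        rw [Ne, ZMod.intCast_zmod_eq_zero_iff_dvd]
        intro h
        exact (Nat.prime_iff_prime_int.1 hp).not_isUnit (hpb.isUnit_of_dvd' h dvd_rfl)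
      rw [neg_eq_neg_one_mul, legendreSym.mul, legendreSym.at_neg_one (by omega),
        ZMod.χ₄_nat_three_mod_four hp4,
        (legendreSym.eq_one_or_neg_one p hb0).resolve_left hsq]
      norm_num
  -- When b ≡ 1 modulo p, the second entry can be made `q`, which divides a - 1. Otherwise b ≢ 1
  -- makes `p` prime to (l - 1)/2 below.
  by_cases hb1 : (p : ℤ) ∣ 1 - b
  · refine (move hb1).eq_one_of_dvd hf ?_
    rw [mul_one]; exact hx.dvd_left
  -- Take `l` ≡ 3 modulo 4: then (l - 1)/2 is odd, and reciprocity turns "b is a square modulo p"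
  -- into "-p is a square modulo l". Euler's criterion gives the exponent (l - 1)/2, which is `l /
  -- 2` in natural division.
  obtain ⟨l, hlq, hl, hlb, hl4⟩ := exists_prime_gt_and_modEq (max q.natAbs p) (p := p) (n := 4)
    (r := b) (s := 3)
    (Nat.Coprime.pow_right 2 (Nat.coprime_two_right.2 (Nat.odd_iff.2 (by omega))))
    hp.ne_zero (by norm_num) hpb ⟨-1, 1, by norm_num⟩
  have := Fact.mk hl
  have hl4' : l % 4 = 3 := by push_cast at hl4; omega
  have hlx := move (c := l) (dvd_sub_comm.1 hlb)
  have hk : x ^ (l / 2) = 1 := by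
    refine pow_eq_one hf hq hl (by omega) hlx ?_
    have h1 : legendreSym l (-p) = 1 := by
      have h2 : legendreSym p l = legendreSym p b := by
        unfold legendreSym
        rw [(ZMod.intCast_eq_intCast_iff_dvd_sub _ _ _).2 hlb]
      rw [neg_eq_neg_one_mul, legendreSym.mul, legendreSym.at_neg_one (by omega),
        ZMod.χ₄_nat_three_mod_four hl4',
        legendreSym.quadratic_reciprocity_three_mod_four hp4 hl4', h2, hsq]
      norm_num
    have h2 := legendreSym.eq_pow l (-p)
    rw [h1] at h2
    rw [← ZMod.intCast_zmod_eq_zero_iff_dvd]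
    push_cast at h2 ⊢
    rw [← h2, sub_self]
  have hpl : p.Coprime (l / 2) := by
    refine (Nat.Prime.coprime_iff_not_dvd hp).2 fun h => hb1 ?_
    have h1 : (p : ℤ) ∣ ((2 * (l / 2) : ℕ) : ℤ) := Int.natCast_dvd_natCast.2 (h.mul_left 2)
    rw [show ((2 * (l / 2) : ℕ) : ℤ) = l - 1 by omega] at h1
    have := h1.add hlb
    rw [← dvd_neg]
    convert this using 1
    abel
  -- Fermat gives the exponent m - 1. As m ≡ -1 modulo `l / 2`, a common divisor of `l / 2` and m -
  -- 1 divides both m + 1 and m - 1, hence 2; but `l / 2` is odd.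
  obtain ⟨m, hmq, hm, hmb, hmk⟩ := exists_prime_gt_and_modEq (max q.natAbs p) (p := p) (n := l / 2)
    (r := b) (s := -1) hpl hp.ne_zero (by omega) hpb isCoprime_one_left.neg_left
  have hmx := move (c := m) (dvd_sub_comm.1 hmb)
  have hm1 : x ^ (m - 1) = 1 := by
    refine pow_eq_one hf hq hm (by omega) hmx ?_
    exact dvd_sub_comm.1
      (Int.ModEq.pow_card_sub_one_eq_one hm hmx.isCoprime.of_mul_right_right).dvd
  refine eq_one_of_pow_of_coprime hk hm1 ?_
  have hm0 := hm.two_le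
  have h1 : l / 2 ∣ m + 1 := by
    rw [← Int.natCast_dvd_natCast, show ((m + 1 : ℕ) : ℤ) = -(-1 - m) by push_cast; ring]
    exact hmk.neg_right
  have h2 : (l / 2).gcd (m - 1) ∣ 2 := by
    have h3 := Nat.dvd_sub ((Nat.gcd_dvd_left (l / 2) (m - 1)).trans h1)
      (Nat.gcd_dvd_right (l / 2) (m - 1))
    rwa [show m + 1 - (m - 1) = 2 by omega] at h3
  have h4 : (l / 2).Coprime 2 := Nat.coprime_two_right.2 (Nat.odd_iff.2 (by omega))
  exact Nat.eq_one_of_dvd_coprimes h4 (Nat.gcd_dvd_left _ _) h2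

end IsSymbol

end UrSp

/-! ### Reduction of congruence subgroups of GL_n(ℤ) to SL₂ blocks. -/

namespace UrSp

/-- Take for t the product of the primes dividing a but not b: a prime factor of a then divides
exactly one of b and tc. -/
theorem exists_isCoprime_add_mul {a b c : ℤ} (ha : a ≠ 0)
    (h : ∀ p : ℕ, p.Prime → (p : ℤ) ∣ a → (p : ℤ) ∣ b → ¬ (p : ℤ) ∣ c) :
    ∃ t, IsCoprime a (b + t * c) := by
  classical
  set s : Finset ℕ := a.natAbs.primeFactors.filter fun p : ℕ => ¬ (p : ℤ) ∣ b with hs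
  refine ⟨((∏ p ∈ s, p : ℕ) : ℤ), ?_⟩
  rw [Int.isCoprime_iff_gcd_eq_one]
  by_contra hne
  obtain ⟨p, hp, hpd⟩ := Nat.exists_prime_and_dvd hne
  have hpa : (p : ℤ) ∣ a := (Int.natCast_dvd_natCast.2 hpd).trans (Int.gcd_dvd_left _ _)
  have hpb : (p : ℤ) ∣ b + ((∏ p ∈ s, p : ℕ) : ℤ) * c :=
    (Int.natCast_dvd_natCast.2 hpd).trans (Int.gcd_dvd_right _ _)
  by_cases hb : (p : ℤ) ∣ b
  · rcases Int.Prime.dvd_mul' hp ((dvd_add_right hb).1 hpb) with h1 | h1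
    · rw [Int.natCast_dvd_natCast, Prime.dvd_finsetProd_iff hp.prime] at h1
      obtain ⟨r, hr, hpr⟩ := h1
      rw [hs, Finset.mem_filter] at hr
      rw [(Nat.prime_dvd_prime_iff_eq hp (Nat.prime_of_mem_primeFactors hr.1)).1 hpr] at hb
      exact hr.2 hb
    · exact h p hp hpa hb h1
  · have : p ∈ s := by
      rw [hs, Finset.mem_filter]
      exact ⟨Nat.mem_primeFactors.2 ⟨hp, Int.natCast_dvd.1 hpa, Int.natAbs_ne_zero.2 ha⟩, hb⟩
    have h2 : (p : ℤ) ∣ ((∏ p ∈ s, p : ℕ) : ℤ) :=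
      Int.natCast_dvd_natCast.2 (Finset.dvd_prod_of_mem (fun p => p) this)
    exact hb ((dvd_add_left (h2.mul_right c)).1 hpb)

variable {n : Type*} [Fintype n] [DecidableEq n]

/-- The matrix which is `(a, b; c, d)` on the coordinates `i, j` and the identity elsewhere. -/
def block (i j : n) (a b c d : ℤ) : Matrix n n ℤ :=
  1 + (single i i (a - 1) + single i j b + single j i c + single j j (d - 1))

/-- The matrices which underlie the elements of a subgroup of `GL`. -/
def matrices (N : Subgroup (GL n ℤ)) : Submonoid (Matrix n n ℤ) :=
  N.toSubmonoid.map (Units.coeHom _)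

theorem mem_matrices {N : Subgroup (GL n ℤ)} {A : Matrix n n ℤ} :
    A ∈ matrices N ↔ ∃ u ∈ N, (u : Matrix n n ℤ) = A := Iff.rfl

theorem coe_mem_matrices {N : Subgroup (GL n ℤ)} {u : GL n ℤ} :
    (u : Matrix n n ℤ) ∈ matrices N ↔ u ∈ N := by
  rw [mem_matrices]
  exact ⟨fun ⟨v, hv, h⟩ => Units.ext h ▸ hv, fun h => ⟨u, h, rfl⟩⟩

theorem isUnit_of_mem_matrices {N : Subgroup (GL n ℤ)} {A : Matrix n n ℤ} (h : A ∈ matrices N) :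
    IsUnit A := by
  obtain ⟨u, -, rfl⟩ := h
  exact u.isUnit

theorem mem_matrices_of_mul_left {N : Subgroup (GL n ℤ)} {A B : Matrix n n ℤ}
    (hA : A ∈ matrices N) (hAB : A * B ∈ matrices N) : B ∈ matrices N := by
  obtain ⟨u, hu, rfl⟩ := hA
  obtain ⟨w, hw, h⟩ := hAB
  refine ⟨u⁻¹ * w, N.mul_mem (N.inv_mem hu) hw, ?_⟩
  change ((u⁻¹ * w : GL n ℤ) : Matrix n n ℤ) = B
  change (w : Matrix n n ℤ) = u * B at h
  rw [Units.val_mul, h, Units.inv_mul_cancel_left]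

theorem mem_matrices_of_mul_right {N : Subgroup (GL n ℤ)} {A B : Matrix n n ℤ}
    (hB : B ∈ matrices N) (hAB : A * B ∈ matrices N) : A ∈ matrices N := by
  obtain ⟨u, hu, rfl⟩ := hB
  obtain ⟨w, hw, h⟩ := hAB
  refine ⟨w * u⁻¹, N.mul_mem hw (N.inv_mem hu), ?_⟩
  change ((w * u⁻¹ : GL n ℤ) : Matrix n n ℤ) = A
  change (w : Matrix n n ℤ) = A * u at h
  rw [Units.val_mul, h, Units.mul_inv_cancel_right]

theorem conj_mem_matrices {N : Subgroup (GL n ℤ)} [N.Normal] {A U V : Matrix n n ℤ}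
    (hA : A ∈ matrices N) (hUV : U * V = 1) : U * A * V ∈ matrices N := by
  obtain ⟨u, hu, rfl⟩ := hA
  have hVU : V * U = 1 := mul_eq_one_comm.1 hUV
  exact ⟨⟨U, V, hUV, hVU⟩ * u * ⟨U, V, hUV, hVU⟩⁻¹, Subgroup.Normal.conj_mem inferInstance u hu _, rfl⟩

/-- `A` is congruent to the identity modulo `q`. -/
def IsCongrOne (q : ℤ) (A : Matrix n n ℤ) : Prop := ∃ X : Matrix n n ℤ, A = 1 + q • X

theorem IsCongrOne.mul {q : ℤ} {A B : Matrix n n ℤ} (hA : IsCongrOne q A) (hB : IsCongrOne q B) :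
    IsCongrOne q (A * B) := by
  obtain ⟨X, rfl⟩ := hA
  obtain ⟨Y, rfl⟩ := hB
  refine ⟨X + Y + q • (X * Y), ?_⟩
  simp only [add_mul, mul_add, one_mul, mul_one, smul_add, smul_mul_assoc, mul_smul_comm]
  abel

theorem isCongrOne_iff {q : ℤ} {A : Matrix n n ℤ} :
    IsCongrOne q A ↔ ∀ r s, q ∣ A r s - (1 : Matrix n n ℤ) r s := by
  constructor
  · rintro ⟨X, rfl⟩ r s
    rw [Matrix.add_apply, Matrix.smul_apply, add_sub_cancel_left]
    exact Dvd.intro _ rfl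
  · intro h
    choose X hX using h
    refine ⟨of X, ?_⟩
    ext r s
    simp [← hX]

/-- `A` agrees with the identity outside the rows and columns in `T`. -/
def IsSupported (T : Finset n) (A : Matrix n n ℤ) : Prop :=
  ∀ s ∉ T, ∀ r, A s r = (1 : Matrix n n ℤ) s r ∧ A r s = (1 : Matrix n n ℤ) r s

theorem IsSupported.mul {T : Finset n} {A B : Matrix n n ℤ} (hA : IsSupported T A)
    (hB : IsSupported T B) : IsSupported T (A * B) := by
  intro s hs r
  rw [Matrix.mul_apply, Matrix.mul_apply]
  simp_rw [fun x => (hA s hs x).1, fun x => (hB s hs x).2]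
  simp [Matrix.one_apply, (hB s hs r).1, (hA s hs r).2]

theorem isSupported_one_add_vecMulVec {T : Finset n} {u v : n → ℤ} (hu : ∀ s ∉ T, u s = 0)
    (hv : ∀ s ∉ T, v s = 0) : IsSupported T (1 + vecMulVec u v) := by
  intro s hs r
  simp [vecMulVec_apply, hu s hs, hv s hs]

theorem isCongrOne_one_add_vecMulVec_left {q : ℤ} {u v : n → ℤ} (hu : ∀ r, q ∣ u r) :
    IsCongrOne q (1 + vecMulVec u v) := by
  rw [isCongrOne_iff]
  intro r s
  simpa [vecMulVec_apply] using (hu r).mul_right _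

theorem isCongrOne_one_add_vecMulVec_right {q : ℤ} {u v : n → ℤ} (hv : ∀ r, q ∣ v r) :
    IsCongrOne q (1 + vecMulVec u v) := by
  rw [isCongrOne_iff]
  intro r s
  simpa [vecMulVec_apply] using (hv s).mul_left _

theorem isSupported_block {T : Finset n} {i j : n} (hi : i ∈ T) (hj : j ∈ T) (a b c d : ℤ) :
    IsSupported T (block i j a b c d) := by
  intro s hs r
  have h1 : i ≠ s := fun h => hs (h ▸ hi)
  have h2 : j ≠ s := fun h => hs (h ▸ hj)
  simp [block, h1, h2]

theorem isCongrOne_block {q : ℤ} {i j : n} {a b c d : ℤ} (ha : q ∣ a - 1) (hb : q ∣ b) (hc : q ∣ c)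
    (hd : q ∣ d - 1) : IsCongrOne q (block i j a b c d) := by
  rw [isCongrOne_iff]
  intro r s
  have aux : ∀ (p : Prop) [Decidable p] (x : ℤ), q ∣ x → q ∣ if p then x else 0 := by
    intro p _ x hx
    split_ifs
    · exact hx
    · exact dvd_zero _
  simp only [block, Matrix.add_apply, single_apply, add_sub_cancel_left]
  exact (((aux _ _ ha).add (aux _ _ hb)).add (aux _ _ hc)).add (aux _ _ hd)

theorem mul_block_apply (A : Matrix n n ℤ) {i j : n} (hij : i ≠ j) (a b c d : ℤ) (r s : n) :
    (A * block i j a b c d) r s =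
      if s = i then A r i * a + A r j * c else if s = j then A r i * b + A r j * d else A r s := by
  have aux : ∀ (k l : n) (x : ℤ), (A * single k l x) r s = if l = s then A r k * x else 0 := by
    intro k l x
    simp [Matrix.mul_apply, single_apply, ite_and]
  simp only [block, mul_add, mul_one, Matrix.add_apply, aux]
  rcases eq_or_ne s i with rfl | hi
  · simp [hij.symm]; ring
  · rcases eq_or_ne s j with rfl | hj
    · simp [hij, hi]; ring
    · simp [hi, hj, hi.symm, hj.symm]

theorem single_eq_vecMulVec (i j : n) (x y : ℤ) :
    single i j (x * y) = vecMulVec (Pi.single i x) (Pi.single j y) := by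
  ext a b
  rw [vecMulVec_apply, single_apply, Pi.single_apply, Pi.single_apply]
  grind

section Reduction

variable {q : ℤ} {N : Subgroup (GL n ℤ)}

theorem one_add_vecMulVec_single_right_mem
    (hN : ∀ i j, i ≠ j → ∀ t, q ∣ t → 1 + single i j t ∈ matrices N) (j : n) {v : n → ℤ}
    (hvj : v j = 0) (hv : ∀ r, q ∣ v r) : 1 + vecMulVec v (Pi.single j 1) ∈ matrices N := by
  rw [← Finset.univ_sum_single v]
  induction (Finset.univ : Finset n) using Finset.induction_on with
  | empty => simp
  | insert r T hr ih =>
    have : 1 + vecMulVec (∑ i ∈ insert r T, Pi.single i (v i)) (Pi.single j 1) =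
        (1 + single r j (v r)) * (1 + vecMulVec (∑ i ∈ T, Pi.single i (v i)) (Pi.single j 1)) := by
      have h0 : single r j (v r) = vecMulVec (Pi.single r (v r)) (Pi.single j 1) := by
        rw [← single_eq_vecMulVec]; simp
      have h1 : (∑ i ∈ T, Pi.single i (v i) : n → ℤ) j = 0 := by
        rw [Finset.sum_apply]
        refine Finset.sum_eq_zero fun x _ => ?_
        rcases eq_or_ne j x with rfl | hx
        · simpa using hvj
        · simp [hx]
      rw [Finset.sum_insert hr, add_vecMulVec, h0, add_mul, mul_add, mul_add, vecMulVec_mul_vecMulVec,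
        single_one_dotProduct, h1]
      simp
      abel
    rw [this]
    refine mul_mem ?_ ih
    rcases eq_or_ne r j with rfl | hrj
    · simp [hvj]
    · exact hN r j hrj _ (hv r)

theorem one_add_vecMulVec_single_left_mem
    (hN : ∀ i j, i ≠ j → ∀ t, q ∣ t → 1 + single i j t ∈ matrices N) (j : n) {v : n → ℤ}
    (hvj : v j = 0) (hv : ∀ r, q ∣ v r) : 1 + vecMulVec (Pi.single j 1) v ∈ matrices N := by
  rw [← Finset.univ_sum_single v]
  induction (Finset.univ : Finset n) using Finset.induction_on with
  | empty => simp
  | insert r T hr ih =>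
    have : 1 + vecMulVec (Pi.single j 1) (∑ i ∈ insert r T, Pi.single i (v i)) =
        (1 + vecMulVec (Pi.single j 1) (∑ i ∈ T, Pi.single i (v i))) * (1 + single j r (v r)) := by
      have h0 : single j r (v r) = vecMulVec (Pi.single j 1) (Pi.single r (v r)) := by
        rw [← single_eq_vecMulVec]; simp
      have h1 : (∑ i ∈ T, Pi.single i (v i) : n → ℤ) j = 0 := by
        rw [Finset.sum_apply]
        refine Finset.sum_eq_zero fun x _ => ?_
        rcases eq_or_ne j x with rfl | hx
        · simpa using hvj
        · simp [hx]
      rw [Finset.sum_insert hr, vecMulVec_add, h0, add_mul, mul_add, mul_add, vecMulVec_mul_vecMulVec,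
        dotProduct_single_one, h1]
      simp
      abel
    rw [this]
    refine mul_mem ih ?_
    rcases eq_or_ne r j with rfl | hrj
    · simp [hvj]
    · exact hN j r hrj.symm _ (hv r)

/-- A subgroup of `GL` that contains the matrices of `SL₂` congruent to the identity modulo `q`, in
any two coordinates, contains all matrices congruent to the identity modulo `q`. -/
theorem mem_of_isCongrOne (hq : 1 < q)
    (hblock : ∀ i j : n, i ≠ j → ∀ a b c d, a * d - b * c = 1 → q ∣ a - 1 → q ∣ b → q ∣ c → q ∣ d - 1 →
      block i j a b c d ∈ matrices N)
    (hdiag : q ∣ 2 → ∀ i : n, 1 - single i i 2 ∈ matrices N) {A : Matrix n n ℤ} (hA : IsUnit A)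
    (hAq : IsCongrOne q A) : A ∈ matrices N := by
  have helem : ∀ i j : n, i ≠ j → ∀ t, q ∣ t → 1 + single i j t ∈ matrices N := by
    intro i j hij t ht
    have := hblock i j hij 1 t 0 1 (by ring) (by simp) ht (by simp) (by simp)
    simpa [block] using this
  suffices ∀ T : Finset n, ∀ A : Matrix n n ℤ, IsUnit A → IsCongrOne q A → IsSupported T A →
      A ∈ matrices N from
    this Finset.univ A hA hAq fun s hs => absurd (Finset.mem_univ s) hs
  clear hA hAq A
  intro T
  induction T using Finset.induction_on with
  | empty =>
    intro A _ _ h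
    have : A = 1 := by
      ext r s
      exact (h r (Finset.notMem_empty r) s).1
    rw [this]
    exact one_mem _
  | insert i T hi ih =>
    intro A hA hAq hAT
    obtain ⟨B, hAB, -⟩ := isUnit_iff_exists.1 hA
    have hrow : ∑ r, A i r * B r i = 1 := by
      rw [← Matrix.mul_apply, hAB, Matrix.one_apply_eq]
    have hAi : ∀ r, r ∉ insert i T → A i r = 0 := by
      intro r hr
      rw [(hAT r hr i).2, Matrix.one_apply_ne]
      rintro rfl
      exact hr (Finset.mem_insert_self _ _)
    have hcong := isCongrOne_iff.1 hAq
    have hii : q ∣ A i i - 1 := by simpa using hcong i i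
    rcases T.eq_empty_or_nonempty with rfl | ⟨j, hj⟩
    -- Only the entry (i, i) is left, and it is ±1; the value -1 is congruent to 1 only if `q`
    -- divides 2.
    · have haa : A i i * B i i = 1 := by
        rwa [Finset.sum_eq_single i (fun r _ hr => by rw [hAi r (by simpa using hr), zero_mul])
          fun h => absurd (Finset.mem_univ i) h] at hrow
      have hAeq : A = 1 - single i i (1 - A i i) := by
        ext r s
        by_cases h : r = i ∧ s = i
        · simp [h.1, h.2]
        · have : A r s = (1 : Matrix n n ℤ) r s := by
            rcases not_and_or.1 h with h | h
            · exact (hAT r (by simpa using h) s).1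
            · exact (hAT s (by simpa using h) r).2
          rw [this, Matrix.sub_apply, single_apply_of_ne, sub_zero]
          exact fun h' => h ⟨h'.1.symm, h'.2.symm⟩
      rw [hAeq]
      rcases Int.eq_one_or_neg_one_of_mul_eq_one haa with h | h <;> rw [h]
      · simp
      · rw [h] at hii
        exact hdiag (by rw [← dvd_neg]; exact hii) i
    · have hji : i ≠ j := by rintro rfl; exact hi hj
      have hij : q ∣ A i j := by simpa [hji] using hcong i j
      have ha0 : A i i ≠ 0 := by
        intro h0
        rw [h0] at hii
        have := Int.le_of_dvd one_pos (by simpa using hii)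
        omega
      set c := ∑ r ∈ T.erase j, A i r * B r i with hc
      have hsum : A i i * B i i + A i j * B j i + c = 1 := by
        rw [← hrow, ← Finset.sum_subset (Finset.subset_univ (insert i T))
          (fun r _ hr => by rw [hAi r hr, zero_mul]), Finset.sum_insert hi,
          ← Finset.add_sum_erase T _ hj, ← hc, add_assoc]
      -- The factor `q` keeps the column operation at level `q`. It costs nothing: primes dividing
      -- `A i i` do not divide `q`, because `A i i` ≡ 1.
      obtain ⟨t, ht⟩ := exists_isCoprime_add_mul (a := A i i) (b := A i j) (c := q * c) ha0 <| by
        intro p hp ha hb hqc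
        have hp1 : ¬ (p : ℤ) ∣ 1 := fun h => hp.one_lt.ne' (by simpa using Int.natCast_dvd_natCast.1 h)
        rcases Int.Prime.dvd_mul' hp hqc with h | h
        · exact hp1 (by simpa using ha.sub (h.trans hii))
        · exact hp1 (hsum ▸ ((ha.mul_right _).add (hb.mul_right _)).add h)
      -- make the entries `(i, i)` and `(i, j)` coprime
      set v : n → ℤ := fun r => if r ∈ T.erase j then t * q * B r i else 0 with hv
      have hvq : ∀ r, q ∣ v r := by
        intro r
        rw [hv]
        dsimp only
        split_ifs
        · exact (dvd_mul_left _ _).mul_right _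
        · exact dvd_zero _
      have hvT : ∀ s ∉ insert i T, v s = 0 := by
        intro s hs
        rw [hv]
        dsimp only
        rw [if_neg fun h => hs (Finset.mem_insert_of_mem (Finset.mem_of_mem_erase h))]
      have hC₁ : 1 + vecMulVec v (Pi.single j 1) ∈ matrices N :=
        one_add_vecMulVec_single_right_mem helem j (by simp [hv]) hvq
      set A₁ := A * (1 + vecMulVec v (Pi.single j 1)) with hA₁
      have hA₁T : IsSupported (insert i T) A₁ :=
        hAT.mul (isSupported_one_add_vecMulVec hvT fun s hs => Pi.single_eq_of_ne
          (by rintro rfl; exact hs (Finset.mem_insert_of_mem hj)) _)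
      have hA₁q : IsCongrOne q A₁ := hAq.mul (isCongrOne_one_add_vecMulVec_left hvq)
      have hA₁ii : A₁ i i = A i i := by
        simp [hA₁, mul_add, mul_vecMulVec, vecMulVec_apply, hji]
      have hA₁ij : A₁ i j = A i j + t * (q * c) := by
        simp only [hA₁, mul_add, mul_vecMulVec, Matrix.add_apply, vecMulVec_apply, mul_one,
          Pi.single_eq_same, mulVec, dotProduct, hv, mul_ite, mul_zero, hc, Finset.mul_sum]
        rw [Finset.sum_ite_mem, Finset.univ_inter]
        congr 1
        exact Finset.sum_congr rfl fun r _ => by ring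
      rw [← hA₁ii, ← hA₁ij] at ht
      refine mem_matrices_of_mul_right hC₁ ?_
      rw [← hA₁]
      have hA₁u : IsUnit A₁ := hA.mul (isUnit_of_mem_matrices hC₁)
      clear_value A₁
      have hcong₁ := isCongrOne_iff.1 hA₁q
      have hii₁ : q ∣ A₁ i i - 1 := by simpa using hcong₁ i i
      have hij₁ : q ∣ A₁ i j := by simpa [hji] using hcong₁ i j
      -- clear the entry `(i, j)`
      obtain ⟨d, c', hdc⟩ := ht
      -- The Bézout pair (d, c') is shifted by c' · (A₁ i j, -A₁ i i). The second coefficient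
      -- becomes c'(1 - A₁ i i), divisible by `q`, so the block has level `q`.
      set e := -c' * (1 - A₁ i i) with he
      set d' := d + c' * A₁ i j with hd'
      have hdet : A₁ i i * d' - A₁ i j * e = 1 := by rw [hd', he]; linear_combination hdc
      have hd'q : q ∣ d' - 1 := by
        rw [show d' - 1 = A₁ i j * e - (A₁ i i - 1) * d' by linear_combination hdet]
        exact (hij₁.mul_right _).sub (hii₁.mul_right _)
      have heq : q ∣ e := by
        rw [he, ← neg_sub, mul_neg]
        exact (hii₁.mul_left _).neg_right
      have hC₂ : block i j d' (-A₁ i j) (-e) (A₁ i i) ∈ matrices N :=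
        hblock i j hji _ _ _ _ (by linear_combination hdet) hd'q hij₁.neg_right heq.neg_right hii₁
      refine mem_matrices_of_mul_right hC₂ ?_
      have hA₂u := hA₁u.mul (isUnit_of_mem_matrices hC₂)
      have hA₂T := hA₁T.mul (isSupported_block (Finset.mem_insert_self i T)
        (Finset.mem_insert_of_mem hj) d' (-A₁ i j) (-e) (A₁ i i))
      have hA₂q := hA₁q.mul (isCongrOne_block hd'q hij₁.neg_right heq.neg_right hii₁ (i := i) (j := j))
      have hA₂ii : (A₁ * block i j d' (-A₁ i j) (-e) (A₁ i i)) i i = 1 := by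
        rw [mul_block_apply _ hji, if_pos rfl]
        linear_combination hdet
      generalize A₁ * block i j d' (-A₁ i j) (-e) (A₁ i i) = A₂ at *
      have hcong₂ := isCongrOne_iff.1 hA₂q
      -- clear the row `i`
      set w : n → ℤ := fun r => if r = i then 0 else -A₂ i r with hw
      have hwq : ∀ r, q ∣ w r := by
        intro r
        rw [hw]
        dsimp only
        split_ifs with h
        · exact dvd_zero _
        · have := hcong₂ i r
          rw [Matrix.one_apply_ne (Ne.symm h), sub_zero] at this
          exact this.neg_right
      have hwT : ∀ s ∉ insert i T, w s = 0 := by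
        intro s hs
        have h : s ≠ i := by rintro rfl; exact hs (Finset.mem_insert_self _ _)
        rw [hw]
        dsimp only
        rw [if_neg h, (hA₂T s hs i).2, Matrix.one_apply_ne h.symm, neg_zero]
      have hiT : ∀ s ∉ insert i T, (Pi.single i 1 : n → ℤ) s = 0 := fun s hs =>
        Pi.single_eq_of_ne (by rintro rfl; exact hs (Finset.mem_insert_self _ _)) _
      have hC₃ : 1 + vecMulVec (Pi.single i 1) w ∈ matrices N :=
        one_add_vecMulVec_single_left_mem helem i (by simp [hw]) hwq
      refine mem_matrices_of_mul_right hC₃ ?_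
      have hA₃u := hA₂u.mul (isUnit_of_mem_matrices hC₃)
      have hA₃T := hA₂T.mul (isSupported_one_add_vecMulVec hiT hwT)
      have hA₃q := hA₂q.mul (isCongrOne_one_add_vecMulVec_right (u := Pi.single i 1) hwq)
      have hA₃row : ∀ r, (A₂ * (1 + vecMulVec (Pi.single i 1) w)) i r = (1 : Matrix n n ℤ) i r := by
        intro r
        simp only [mul_add, mul_one, mul_vecMulVec, Matrix.add_apply, vecMulVec_apply,
          mulVec_single_one, col_apply, hA₂ii, one_mul, hw]
        split_ifs with h
        · rw [h, hA₂ii]; simp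
        · rw [Matrix.one_apply_ne (Ne.symm h), add_neg_cancel]
      generalize A₂ * (1 + vecMulVec (Pi.single i 1) w) = A₃ at *
      have hcong₃ := isCongrOne_iff.1 hA₃q
      -- clear the column `i`
      set z : n → ℤ := fun r => if r = i then 0 else -A₃ r i with hz
      have hzq : ∀ r, q ∣ z r := by
        intro r
        rw [hz]
        dsimp only
        split_ifs with h
        · exact dvd_zero _
        · have := hcong₃ r i
          rw [Matrix.one_apply_ne h, sub_zero] at this
          exact this.neg_right
      have hzT : ∀ s ∉ insert i T, z s = 0 := by
        intro s hs
        have h : s ≠ i := by rintro rfl; exact hs (Finset.mem_insert_self _ _)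
        rw [hz]
        dsimp only
        rw [if_neg h, (hA₃T s hs i).1, Matrix.one_apply_ne h, neg_zero]
      have hC₄ : 1 + vecMulVec z (Pi.single i 1) ∈ matrices N :=
        one_add_vecMulVec_single_right_mem helem i (by simp [hz]) hzq
      refine mem_matrices_of_mul_left hC₄ ?_
      refine ih _ ((isUnit_of_mem_matrices hC₄).mul hA₃u)
        ((isCongrOne_one_add_vecMulVec_left hzq).mul hA₃q) fun s hs r => ?_
      rcases eq_or_ne s i with rfl | hsi
      · have hent : ∀ x y, ((1 + vecMulVec z (Pi.single s 1)) * A₃) x y =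
            A₃ x y + z x * (1 : Matrix n n ℤ) s y := by
          intro x y
          rw [add_mul, one_mul, vecMulVec_mul, Matrix.add_apply, vecMulVec_apply,
            single_one_vecMul, row_apply, hA₃row]
        rw [hent, hent]
        constructor
        · rw [hA₃row]; simp [hz]
        · rw [Matrix.one_apply_eq, mul_one]
          simp only [hz]
          split_ifs with h
          · rw [h, hA₃row, add_zero]
          · rw [add_neg_cancel, Matrix.one_apply_ne h]
      · exact ((isSupported_one_add_vecMulVec hzT hiT).mul hA₃T) s
          (by simp [hsi, hs]) r

end Reduction

end UrSp

/-! ### SL₂ blocks in subgroups of GL_n(ℤ): the Mennicke and Euclidean arguments. -/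

namespace UrSp

section Embedding

variable {m n : Type*} [Fintype m] [DecidableEq m] [Fintype n] [DecidableEq n]

/-- The matrix of the inclusion of coordinates along `ι`. -/
def inclusion (ι : m → n) : Matrix n m ℤ := of fun r k => if r = ι k then 1 else 0

theorem inclusion_transpose_mul {ι : m → n} (hι : Function.Injective ι) :
    (inclusion ι)ᵀ * inclusion ι = 1 := by
  ext k l
  simp [inclusion, Matrix.mul_apply, Matrix.one_apply, hι.eq_iff, eq_comm]

/-- Extension of matrices by the identity along an injection of the coordinates. -/
def extend {ι : m → n} (hι : Function.Injective ι) : Matrix m m ℤ →* Matrix n n ℤ where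
  toFun A := 1 + inclusion ι * (A - 1) * (inclusion ι)ᵀ
  map_one' := by simp
  map_mul' A B := by
    have h : inclusion ι * (A - 1) * (inclusion ι)ᵀ * (inclusion ι * (B - 1) * (inclusion ι)ᵀ) =
        inclusion ι * ((A - 1) * (B - 1)) * (inclusion ι)ᵀ := by
      calc _ = inclusion ι * (A - 1) * ((inclusion ι)ᵀ * inclusion ι) * (B - 1) *
          (inclusion ι)ᵀ := by simp only [Matrix.mul_assoc]
        _ = _ := by rw [inclusion_transpose_mul hι, Matrix.mul_one]; simp only [Matrix.mul_assoc]
    rw [add_mul, mul_add, mul_add, h, one_mul, mul_one, one_mul,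
      show A * B - 1 = (A - 1) * (B - 1) + (A - 1) + (B - 1) by noncomm_ring]
    simp only [Matrix.mul_add, Matrix.add_mul]
    abel

theorem inclusion_mul_single (ι : m → n) (k l : m) (x : ℤ) :
    inclusion ι * single k l x * (inclusion ι)ᵀ = single (ι k) (ι l) x := by
  have h (k : m) (x : ℤ) : inclusion ι *ᵥ Pi.single k x = Pi.single (ι k) x := by
    ext r
    simp [inclusion, Pi.single_apply]
  rw [← mul_one x, single_eq_vecMulVec, single_eq_vecMulVec, mul_vecMulVec, vecMulVec_mul,
    vecMul_transpose, h, h]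

theorem extend_one_add_single {ι : m → n} (hι : Function.Injective ι) (k l : m) (x : ℤ) :
    extend hι (1 + single k l x) = 1 + single (ι k) (ι l) x := by
  change 1 + inclusion ι * (1 + single k l x - 1) * (inclusion ι)ᵀ = _
  rw [add_sub_cancel_left, inclusion_mul_single]

theorem extend_block {ι : m → n} (hι : Function.Injective ι) (k l : m) (a b c d : ℤ) :
    extend hι (block k l a b c d) = block (ι k) (ι l) a b c d := by
  change 1 + inclusion ι * (block k l a b c d - 1) * (inclusion ι)ᵀ = _
  simp only [block, add_sub_cancel_left, Matrix.mul_add, Matrix.add_mul, inclusion_mul_single]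

theorem block_fin_two (a b c d : ℤ) : block (0 : Fin 2) 1 a b c d = !![a, b; c, d] := by
  ext i j
  fin_cases i <;> fin_cases j <;> simp [block]

theorem block_fin_three (a b c d : ℤ) :
    block (0 : Fin 3) 1 a b c d = !![a, b, 0; c, d, 0; 0, 0, 1] := by
  ext i j
  fin_cases i <;> fin_cases j <;> simp [block]

theorem block_mul {i j : n} (hij : i ≠ j) (a b c d a' b' c' d' : ℤ) :
    block i j a b c d * block i j a' b' c' d' =
      block i j (a * a' + b * c') (a * b' + b * d') (c * a' + d * c') (c * b' + d * d') := by
  have hι : Function.Injective ![i, j] := by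
    intro k l
    fin_cases k <;> fin_cases l <;> simp [hij, hij.symm]
  have h (a b c d : ℤ) : block i j a b c d = extend hι !![a, b; c, d] := by
    rw [← block_fin_two, extend_block]; rfl
  rw [h, h, h, ← map_mul, Matrix.mul_fin_two]

end Embedding

section Block

variable {n : Type*} [Fintype n] [DecidableEq n] {N : Subgroup (GL n ℤ)}

/-- In dimension at least three, normal subgroups containing the elementary matrices of level `q`
contain the level `q` subgroup of any `SL₂`. -/
theorem block_mem_of_normal [N.Normal] {q : ℤ} (hq : q ≠ 0) (hn : 3 ≤ Fintype.card n)
    (helem : ∀ i j : n, i ≠ j → ∀ t, 1 + single i j (q * t) ∈ matrices N) {i j : n} (hij : i ≠ j)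
    {a b c d : ℤ} (h : a * d - b * c = 1) (ha : q ∣ a - 1) (hb : q ∣ b) (hc : q ∣ c)
    (hd : q ∣ d - 1) : block i j a b c d ∈ matrices N := by
  obtain ⟨k, hk⟩ : ∃ k, k ∉ ({i, j} : Finset n) := by
    by_contra! hk
    have := Finset.card_le_card (fun x _ => hk x : (Finset.univ : Finset n) ⊆ {i, j})
    rw [Finset.card_univ, Finset.card_pair hij] at this
    omega
  have hki : k ≠ i := fun h => hk (by simp [h])
  have hkj : k ≠ j := fun h => hk (by simp [h])
  have hι : Function.Injective ![i, j, k] := by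
    intro k l
    fin_cases k <;> fin_cases l <;> simp [hij, hij.symm, hki, hki.symm, hkj, hkj.symm]
  -- SL₃ on the coordinates i, j, k, taken modulo `N`: the hypothesis says that level `q`
  -- transvections die, so the image of a corner is a Mennicke symbol.
  set f : Matrix.SpecialLinearGroup (Fin 3) ℤ →* GL n ℤ ⧸ N :=
    (QuotientGroup.mk' N).comp ((Units.map (extend hι)).comp Matrix.SpecialLinearGroup.toGL) with hf
  have key (A : Matrix.SpecialLinearGroup (Fin 3) ℤ) :
      f A = 1 ↔ extend hι (A : Matrix (Fin 3) (Fin 3) ℤ) ∈ matrices N := by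
    change ((Units.map (extend hι) (Matrix.SpecialLinearGroup.toGL A) : GL n ℤ) : GL n ℤ ⧸ N) = 1 ↔ _
    rw [QuotientGroup.eq_one_iff, ← coe_mem_matrices]
    rfl
  have hfe : ∀ i j hij t, f (elem i j hij (q * t)) = 1 := by
    intro r s hrs t
    rw [key, coe_elem, extend_one_add_single]
    exact helem _ _ (hι.ne hrs) t
  have hx : IsSymbol q f a b (f (corner a b c d h)) := ⟨c, d, h, ha, hb, hc, hd, rfl⟩
  have := (key _).1 (hx.eq_one hfe hq)
  rwa [coe_corner, ← block_fin_three, extend_block] at this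

/-- Division by 2b with remainder centred at 0: even quotients only bring the remainder down to |b|.
-/
theorem exists_abs_add_le (a : ℤ) {b : ℤ} (hb : b ≠ 0) : ∃ s, |a + 2 * s * b| ≤ |b| := by
  have h1 := Int.emod_nonneg (a + |b|) (mul_ne_zero two_ne_zero hb)
  have h2 := Int.emod_lt_abs (a + |b|) (mul_ne_zero two_ne_zero hb)
  have h3 := Int.emod_add_mul_ediv (a + |b|) (2 * b)
  rw [abs_mul, abs_two] at h2
  refine ⟨-((a + |b|) / (2 * b)), abs_le.2 ⟨?_, ?_⟩⟩ <;> nlinarith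

/-- Euclid's algorithm on the first row with even quotients. Since a stays odd and b even, their
absolute values are never equal, so |b| strictly decreases. At b = 0 the diagonal is ±(1, 1), and
the negative sign is the product of two sign matrices. -/
theorem block_mem_of_level_two (helem : ∀ i j : n, i ≠ j → ∀ t, 1 + single i j (2 * t) ∈ matrices N)
    (hdiag : ∀ i : n, 1 - single i i 2 ∈ matrices N) {i j : n} (hij : i ≠ j) {a b c d : ℤ}
    (h : a * d - b * c = 1) (ha : 2 ∣ a - 1) (hb : 2 ∣ b) (hc : 2 ∣ c) :
    block i j a b c d ∈ matrices N := by
  have hup (t) : block i j 1 (2 * t) 0 1 ∈ matrices N := by simpa [block] using helem i j hij t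
  have hlow (t) : block i j 1 0 (2 * t) 1 ∈ matrices N := by simpa [block] using helem j i hij.symm t
  induction hk : b.natAbs using Nat.strong_induction_on generalizing a b c d with
  | _ k ih =>
    subst hk
    rcases eq_or_ne b 0 with rfl | hb0
    · obtain ⟨c', rfl⟩ := hc
      have had : a * d = 1 := by linarith
      rcases Int.eq_one_or_neg_one_of_mul_eq_one' had with ⟨rfl, rfl⟩ | ⟨rfl, rfl⟩
      · exact hlow c'
      · have h1 : block i j (-1) 0 0 (-1) ∈ matrices N := by
          convert mul_mem (hdiag i) (hdiag j) using 1
          have h2 : single i i (2 : ℤ) * single j j 2 = 0 := by simp [hij]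
          rw [sub_mul, mul_sub, mul_sub, h2, block]
          have h3 (i : n) : single i i (-1 - 1 : ℤ) = -single i i 2 := by
            rw [single_neg]; norm_num
          rw [h3, h3]
          simp
          abel
        have := mul_mem h1 (hlow (-c'))
        rw [block_mul hij] at this
        convert this using 1
        congr 1 <;> ring
    · obtain ⟨s, hs⟩ := exists_abs_add_le a hb0
      have ha0 : a + 2 * s * b ≠ 0 := by
        intro h0
        obtain ⟨x, hx⟩ := ha
        have : 2 * (x + s * b) = -1 := by linarith
        omega
      obtain ⟨t, ht⟩ := exists_abs_add_le b ha0
      have hlt : |b + 2 * t * (a + 2 * s * b)| < |b| := by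
        refine ht.trans_lt (lt_of_le_of_ne hs fun heq => ?_)
        obtain ⟨x, hx⟩ := ha
        obtain ⟨y, rfl⟩ := hb
        rcases abs_eq_abs.1 heq with h' | h'
        · have : 2 * (x + s * (2 * y) - y) = -1 := by linarith
          omega
        · have : 2 * (x + s * (2 * y) + y) = -1 := by linarith
          omega
      refine mem_matrices_of_mul_right (hlow s) ?_
      rw [block_mul hij]
      refine mem_matrices_of_mul_right (hup t) ?_
      rw [block_mul hij]
      refine ih _ ?_ ?_ ?_ ?_ ?_ rfl
      · zify
        convert hlt using 2
        ring
      · linear_combination h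
      · obtain ⟨x, hx⟩ := ha
        exact ⟨x + b * s, by linear_combination hx⟩
      · obtain ⟨y, rfl⟩ := hb
        exact ⟨y + t * (a + 2 * s * (2 * y)), by ring⟩
      · obtain ⟨y, rfl⟩ := hc
        exact ⟨y + d * s, by ring⟩

end Block

end UrSp

/-! ### Conjugation in GL_n(ℤ). -/

namespace UrSp

section Normal

variable {n : Type*} [Fintype n] [DecidableEq n] {N : Subgroup (GL n ℤ)}

theorem submatrix_mem_matrices [N.Normal] {A : Matrix n n ℤ} (hA : A ∈ matrices N)
    (σ : Equiv.Perm n) : A.submatrix σ σ ∈ matrices N := by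
  have h1 : σ.toPEquiv.toMatrix * A * σ.symm.toPEquiv.toMatrix = A.submatrix σ σ := by
    rw [PEquiv.toMatrix_toPEquiv_mul, PEquiv.mul_toMatrix_toPEquiv]
    simp
  rw [← h1]
  refine conj_mem_matrices hA ?_
  rw [← PEquiv.toMatrix_trans, ← Equiv.toPEquiv_trans]
  simp

theorem exists_perm_apply_eq {i j k l : n} (hij : i ≠ j) (hkl : k ≠ l) :
    ∃ σ : Equiv.Perm n, σ i = k ∧ σ j = l := by
  refine ⟨Equiv.swap (Equiv.swap i k j) l * Equiv.swap i k, ?_, by simp⟩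
  rw [Equiv.Perm.mul_apply, Equiv.swap_apply_left]
  refine Equiv.swap_apply_of_ne_of_ne (fun h => hij ?_) hkl
  exact (Equiv.swap i k).injective (by rw [Equiv.swap_apply_left, ← h])

theorem one_add_single_mem_of_mem [N.Normal] {i j : n} (hij : i ≠ j) {t : ℤ}
    (h : 1 + single i j t ∈ matrices N) {k l : n} (hkl : k ≠ l) :
    1 + single k l t ∈ matrices N := by
  obtain ⟨σ, rfl, rfl⟩ := exists_perm_apply_eq hij hkl
  convert submatrix_mem_matrices h σ.symm using 1
  ext r s
  simp [single_apply, Matrix.one_apply, Equiv.eq_symm_apply]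

theorem one_add_single_mul {i j : n} (hij : i ≠ j) (s t : ℤ) :
    (1 + single i j s) * (1 + single i j t) = 1 + single i j (s + t) := by
  simp [mul_add, add_mul, single_add, hij.symm]
  abel

theorem one_add_single_mul_mem {i j : n} (hij : i ≠ j) {q : ℤ}
    (h : 1 + single i j q ∈ matrices N) (t : ℤ) : 1 + single i j (q * t) ∈ matrices N := by
  induction t using Int.induction_on with
  | zero => simp
  | succ t ih =>
    rw [mul_add, mul_one, ← one_add_single_mul hij]
    exact mul_mem ih h
  | pred t ih =>
    refine mem_matrices_of_mul_right h ?_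
    rw [one_add_single_mul hij]
    convert ih using 3
    ring

theorem one_sub_single_mem_of_mem [N.Normal] {i : n} {t : ℤ}
    (h : 1 - single i i t ∈ matrices N) (k : n) : 1 - single k k t ∈ matrices N := by
  obtain ⟨σ, rfl⟩ : ∃ σ : Equiv.Perm n, σ i = k := ⟨Equiv.swap i k, by simp⟩
  convert submatrix_mem_matrices h σ.symm using 1
  ext r s
  simp [single_apply, Matrix.one_apply, Equiv.eq_symm_apply]

/-- The commutator of a transvection with a sign matrix is the square of the transvection; hence
level 2 needs no `X` among the generators. -/
theorem one_add_single_two_mem [N.Normal] {i : n} (h : 1 - single i i 2 ∈ matrices N) {k l : n}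
    (hkl : k ≠ l) : 1 + single k l 2 ∈ matrices N := by
  have hk := one_sub_single_mem_of_mem h k
  have h1 := conj_mem_matrices hk (U := 1 + single k l 1) (V := 1 + single k l (-1))
    (by rw [one_add_single_mul hkl]; simp)
  have h2 : (1 + single k l 2) * (1 - single k k 2) =
      (1 + single k l 1) * (1 - single k k 2) * (1 + single k l (-1)) := by
    have hE : single k l (1 : ℤ) * single k l 1 = 0 := by simp [hkl.symm]
    have hEP : single k l (1 : ℤ) * single k k 1 = 0 := by simp [hkl.symm]
    have hPE : single k k (1 : ℤ) * single k l 1 = single k l 1 := by simp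
    rw [← one_add_one_eq_two, single_add, single_add, ← single_neg]
    simp only [mul_add, add_mul, mul_sub, sub_mul, mul_neg, hE, hEP, hPE, mul_one, one_mul,
      zero_mul]
    abel
  exact mem_matrices_of_mul_right hk (h2 ▸ h1)

end Normal

/-! ### Structure of urSp(2g): diagonal and unipotent factors. -/

variable {g : ℕ}

/-- The underlying matrix of an element of `urSp(2g)`. -/
def mat (x : urSp g) : Matrix (Fin g ⊕ Fin g) (Fin g ⊕ Fin g) ℤ := x.1.1

theorem mat_injective : Function.Injective (mat (g := g)) := fun _ _ h =>
  Subtype.ext (Subtype.ext h)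

theorem mat_mul (x y : urSp g) : mat (x * y) = mat x * mat y := rfl

theorem mat_one : mat (1 : urSp g) = 1 := rfl

theorem mat_ofBlocks {A B D : Matrix (Fin g) (Fin g) ℤ} (h : Aᵀ * D = 1) (h' : Bᵀ * D = Dᵀ * B) :
    mat (ofBlocks A B D h h') = fromBlocks A B 0 D := rfl

theorem exists_eq_ofBlocks (x : urSp g) : ∃ A B D h h', x = ofBlocks A B D h h' := by
  have h0 : (mat x).toBlocks₂₁ = 0 := x.2
  have h1 := fromBlocks_toBlocks (mat x)
  rw [h0] at h1
  have h2 : mat x ∈ symplecticGroup (Fin g) ℤ := x.1.2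
  rw [← h1, SymplecticGroup.fromBlocks_mem_iff] at h2
  exact ⟨_, _, _, by simpa using h2.2.2, h2.2.1, mat_injective h1.symm⟩

/-- The block D is forced to be ᵗA⁻¹, however that inverse is written. -/
theorem ofBlocks_congr {A B D D' : Matrix (Fin g) (Fin g) ℤ} {h : Aᵀ * D = 1}
    {h' : Bᵀ * D = Dᵀ * B} {k : Aᵀ * D' = 1} {k' : Bᵀ * D' = D'ᵀ * B} :
    ofBlocks A B D h h' = ofBlocks A B D' k k' := by
  have : D = D' := by
    rw [← Matrix.one_mul D, ← mul_eq_one_comm.1 k, Matrix.mul_assoc, h, Matrix.mul_one]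
  subst this
  rfl

theorem mem_level_iff {d : ℕ} {x : urSp g} :
    x ∈ level g d ↔ ∀ r s, (d : ℤ) ∣ mat x r s - (1 : Matrix _ _ ℤ) r s := by
  have h1 : x ∈ level g d ↔ (mat x).map (Int.castRingHom (ZMod d)) = 1 := by
    rw [level, MonoidHom.mem_ker, Subtype.ext_iff]
    rfl
  rw [h1, ← Matrix.ext_iff]
  refine forall₂_congr fun r s => ?_
  rw [← ZMod.intCast_eq_intCast_iff_dvd_sub, Matrix.map_apply, Matrix.one_apply, Matrix.one_apply]
  split_ifs <;> simp [eq_comm]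

theorem ofBlocks_mem_level_iff {d : ℕ} {A B D : Matrix (Fin g) (Fin g) ℤ} {h : Aᵀ * D = 1}
    {h' : Bᵀ * D = Dᵀ * B} :
    ofBlocks A B D h h' ∈ level g d ↔
      IsCongrOne (d : ℤ) A ∧ (∀ i j, (d : ℤ) ∣ B i j) ∧ IsCongrOne (d : ℤ) D := by
  rw [mem_level_iff, mat_ofBlocks, ← fromBlocks_one, isCongrOne_iff, isCongrOne_iff]
  simp [Sum.forall, forall_and, -fromBlocks_one]

/-- The block diagonal embedding of `GL_g(ℤ)`. -/
def diagHom (g : ℕ) : GL (Fin g) ℤ →* urSp g where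
  toFun u := ofBlocks (u : Matrix (Fin g) (Fin g) ℤ) 0 ((u⁻¹ : GL (Fin g) ℤ) : Matrix _ _ ℤ)ᵀ
    (by rw [← transpose_mul, Units.inv_mul, transpose_one]) (by simp)
  map_one' := mat_injective (by rw [mat_ofBlocks, mat_one]; simp)
  map_mul' u v := mat_injective (by
    simp only [mat_mul, mat_ofBlocks, fromBlocks_multiply, _root_.mul_inv_rev, Units.val_mul,
      transpose_mul]
    simp)

theorem diagHom_apply (u : GL (Fin g) ℤ) : diagHom g u = ofBlocks (u : Matrix (Fin g) (Fin g) ℤ) 0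
    ((u⁻¹ : GL (Fin g) ℤ) : Matrix _ _ ℤ)ᵀ
    (by rw [← transpose_mul, Units.inv_mul, transpose_one]) (by simp) := rfl

theorem ofBlocks_eq_diagHom {A D : Matrix (Fin g) (Fin g) ℤ} {h : Aᵀ * D = 1}
    {h' : (0 : Matrix (Fin g) (Fin g) ℤ)ᵀ * D = Dᵀ * 0} (u : GL (Fin g) ℤ)
    (hu : (u : Matrix (Fin g) (Fin g) ℤ) = A) : ofBlocks A 0 D h h' = diagHom g u := by
  subst hu
  rw [diagHom_apply]
  exact ofBlocks_congr

/-- The unipotent element with upper right block `B`. -/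
def upper (B : Matrix (Fin g) (Fin g) ℤ) (hB : Bᵀ = B) : urSp g :=
  ofBlocks 1 B 1 (by simp) (by simp [hB])

theorem mat_upper {B : Matrix (Fin g) (Fin g) ℤ} (hB : Bᵀ = B) :
    mat (upper B hB) = fromBlocks 1 B 0 1 := rfl

theorem upper_pow {B : Matrix (Fin g) (Fin g) ℤ} (hB : Bᵀ = B) (k : ℕ) :
    upper B hB ^ k = upper (k • B) (by rw [transpose_smul, hB]) := by
  induction k with
  | zero => exact mat_injective (by rw [pow_zero, mat_upper, mat_one]; simp)
  | succ k ih =>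
    apply mat_injective
    rw [pow_succ, ih, mat_mul, mat_upper, mat_upper, mat_upper, fromBlocks_multiply, succ_nsmul]
    simp [add_comm]

/-- The symmetric matrices whose unipotent element lies in `K`. -/
def upperPart (K : Subgroup (urSp g)) : AddSubgroup (Matrix (Fin g) (Fin g) ℤ) where
  carrier := {B | ∃ hB, upper B hB ∈ K}
  zero_mem' := ⟨transpose_zero, by
    convert K.one_mem
    exact mat_injective (by rw [mat_upper, mat_one]; simp)⟩
  add_mem' := by
    rintro B C ⟨hB, hBK⟩ ⟨hC, hCK⟩
    refine ⟨by rw [transpose_add, hB, hC], ?_⟩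
    convert K.mul_mem hBK hCK
    apply mat_injective
    rw [mat_mul, mat_upper, mat_upper, mat_upper, fromBlocks_multiply]
    simp [add_comm]
  neg_mem' := by
    rintro B ⟨hB, hBK⟩
    refine ⟨by rw [transpose_neg, hB], ?_⟩
    convert K.inv_mem hBK
    rw [eq_inv_iff_mul_eq_one]
    apply mat_injective
    rw [mat_mul, mat_upper, mat_upper, fromBlocks_multiply, mat_one]
    simp

theorem conj_mem_upperPart {K : Subgroup (urSp g)} [K.Normal] {B : Matrix (Fin g) (Fin g) ℤ}
    (hB : B ∈ upperPart K) {U V : Matrix (Fin g) (Fin g) ℤ} (hUV : U * V = 1) :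
    U * B * Uᵀ ∈ upperPart K := by
  obtain ⟨hB, hBK⟩ := hB
  refine ⟨by simp [hB, Matrix.mul_assoc], ?_⟩
  have hVU : V * U = 1 := mul_eq_one_comm.1 hUV
  convert Subgroup.Normal.conj_mem inferInstance _ hBK (diagHom g ⟨U, V, hUV, hVU⟩) using 1
  rw [eq_mul_inv_iff_mul_eq]
  apply mat_injective
  rw [mat_mul, mat_mul, mat_upper, mat_upper, diagHom_apply, mat_ofBlocks, fromBlocks_multiply,
    fromBlocks_multiply]
  dsimp only
  congr 1 <;> simp [Matrix.mul_assoc, ← transpose_mul, hVU]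

/-- Polarization: the rank one matrices v ᵗv on the right lie in the orbit of one S_{k,k} under B ↦
U B ᵗU. -/
theorem S_eq_of_ne {i j : Fin g} (hij : i ≠ j) : S i j = vecMulVec (Pi.single i 1 + Pi.single j 1)
    (Pi.single i 1 + Pi.single j 1) - S i i - S j j := by
  rw [S, S, S, if_neg hij, if_pos rfl, if_pos rfl, add_vecMulVec, vecMulVec_add, vecMulVec_add]
  simp only [← single_eq_vecMulVec, mul_one]
  abel

theorem smul_S_mem_upperPart {K : Subgroup (urSp g)} [K.Normal] {d : ℕ} {k : Fin g}
    (hk : Y k k ^ d ∈ K) (i j : Fin g) : d • S i j ∈ upperPart K := by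
  have h0 : d • S k k ∈ upperPart K := by
    refine ⟨by rw [transpose_smul, S_transpose], ?_⟩
    rw [← upper_pow (S_transpose k k)]
    exact hk
  have hS (i : Fin g) : S i i = vecMulVec (Pi.single i 1) (Pi.single i 1) := by
    rw [← single_eq_vecMulVec, S, if_pos rfl, mul_one]
  have conj {U V : Matrix (Fin g) (Fin g) ℤ} (hUV : U * V = 1) {v : Fin g → ℤ}
      (hv : d • vecMulVec v v ∈ upperPart K) :
      d • vecMulVec (U *ᵥ v) (U *ᵥ v) ∈ upperPart K := by
    convert conj_mem_upperPart hv hUV using 1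
    rw [Matrix.mul_smul, Matrix.smul_mul, mul_vecMulVec, vecMulVec_mul, vecMul_transpose]
  have hdiag (i : Fin g) : d • S i i ∈ upperPart K := by
    rw [hS] at h0 ⊢
    have := conj (U := (Equiv.swap i k).toPEquiv.toMatrix) (V := (Equiv.swap i k).toPEquiv.toMatrix)
      (by rw [← PEquiv.toMatrix_trans, ← Equiv.toPEquiv_trans]; simp) h0
    convert this using 3 <;>
    · ext r
      simp [PEquiv.toMatrix_apply, Equiv.toPEquiv_apply, Pi.single_apply, Equiv.swap_apply_eq_iff]
  rcases eq_or_ne i j with rfl | hij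
  · exact hdiag i
  · rw [S_eq_of_ne hij, smul_sub, smul_sub]
    refine sub_mem (sub_mem ?_ (hdiag i)) (hdiag j)
    have h1 := hdiag i
    rw [hS] at h1
    -- This U sends e_i to e_i + e_j.
    have := conj (U := 1 + single j i 1) (V := 1 + single j i (-1))
      (by rw [one_add_single_mul hij.symm]; simp) h1
    have h2 : (1 + single j i 1) *ᵥ Pi.single i 1 = (Pi.single i 1 + Pi.single j 1 : Fin g → ℤ) := by
      rw [add_mulVec, one_mulVec, ← mul_one (1 : ℤ), single_eq_vecMulVec, mul_one, vecMulVec_mulVec]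
      simp
    rwa [h2] at this

theorem smul_mem_upperPart {K : Subgroup (urSp g)} [K.Normal] {d : ℕ} {k : Fin g}
    (hk : Y k k ^ d ∈ K) {B : Matrix (Fin g) (Fin g) ℤ} (hB : Bᵀ = B)
    (hBd : ∀ i j, (d : ℤ) ∣ B i j) : B ∈ upperPart K := by
  have hd : B = ∑ i, ∑ j, ((if i = j then single i j (B i j) else 0) +
      (if i < j then single i j (B i j) + single j i (B i j) else 0)) := by
    have hBs (i j) : B j i = B i j := congrFun (congrFun hB i) j
    have h1 : ∑ i, ∑ j, (if i < j then single j i (B i j) else 0) =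
        ∑ i, ∑ j, (if j < i then single i j (B i j) else 0) := by
      rw [Finset.sum_comm]
      simp only [hBs]
    have h2 : ∀ i j, single i j (B i j) = (if i = j then single i j (B i j) else 0) +
        ((if i < j then single i j (B i j) else 0) + (if j < i then single i j (B i j) else 0)) := by
      intro i j
      rcases lt_trichotomy i j with h | h | h
      · simp [h, h.ne, h.not_gt]
      · simp [h]
      · simp [h, h.ne', h.not_gt]
    have h3 : ∀ i j, (if i < j then single i j (B i j) + single j i (B i j) else 0) =
        (if i < j then single i j (B i j) else 0) + (if i < j then single j i (B i j) else 0) := by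
      intro i j
      split_ifs <;> simp
    conv_lhs => rw [matrix_eq_sum_single B]
    simp only [h3, Finset.sum_add_distrib, h1]
    simp only [← Finset.sum_add_distrib]
    exact Finset.sum_congr rfl fun i _ => Finset.sum_congr rfl fun j _ => h2 i j
  rw [hd]
  refine sum_mem fun i _ => sum_mem fun j _ => ?_
  obtain ⟨c, hc⟩ := hBd i j
  have key := zsmul_mem (smul_S_mem_upperPart hk i j) c
  rw [← natCast_zsmul, smul_smul, mul_comm, ← hc] at key
  refine add_mem ?_ ?_ <;> split_ifs with h
  · convert key using 1
    simp [S, h, smul_single]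
  · exact zero_mem _
  · convert key using 1
    simp [S, h.ne, smul_single]
  · exact zero_mem _

/-- Since ᵗD = A⁻¹, the element with blocks (A, B; 0, D) is diag(A, D) times the unipotent with
block ᵗD B, which is still divisible by d. -/
theorem level_le {K : Subgroup (urSp g)} [K.Normal] {d : ℕ} {k : Fin g} (hk : Y k k ^ d ∈ K)
    (hK : ∀ A : Matrix (Fin g) (Fin g) ℤ, IsUnit A → IsCongrOne (d : ℤ) A →
      A ∈ matrices (K.comap (diagHom g))) : level g d ≤ K := by
  intro x hx
  obtain ⟨A, B, D, h, h', rfl⟩ := exists_eq_ofBlocks x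
  obtain ⟨hA, hB, -⟩ := ofBlocks_mem_level_iff.1 hx
  have hDA : Dᵀ * A = 1 := by
    have := congrArg transpose h
    simpa using this
  have hAD := mul_eq_one_comm.1 hDA
  set u : GL (Fin g) ℤ := ⟨A, Dᵀ, hAD, hDA⟩ with hu
  have hC : (Dᵀ * B)ᵀ = Dᵀ * B := by rw [transpose_mul, transpose_transpose, h']
  have hx : ofBlocks A B D h h' = diagHom g u * upper (Dᵀ * B) hC := by
    apply mat_injective
    rw [mat_mul, mat_upper, diagHom_apply, mat_ofBlocks, mat_ofBlocks, fromBlocks_multiply]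
    simp [hu, ← Matrix.mul_assoc, hAD]
  rw [hx]
  refine K.mul_mem ?_ ?_
  · exact (coe_mem_matrices (N := K.comap (diagHom g)) (u := u)).1 (hK A u.isUnit hA)
  · refine (smul_mem_upperPart hk hC fun i j => ?_).choose_spec
    rw [Matrix.mul_apply]
    exact Finset.dvd_sum fun r _ => (hB r j).mul_left _

end UrSp

/-! ### The generators and their normal closures. -/

namespace UrSp

variable {g : ℕ}

/-- The transvection `1 + t e_{i,j}` as an element of `GL`. -/
def elemGL {i j : Fin g} (hij : i ≠ j) (t : ℤ) : GL (Fin g) ℤ :=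
  ⟨1 + single i j t, 1 + single i j (-t), by rw [one_add_single_mul hij]; simp,
    by rw [one_add_single_mul hij]; simp⟩

theorem elemGL_pow {i j : Fin g} (hij : i ≠ j) (t : ℤ) (k : ℕ) :
    elemGL hij t ^ k = elemGL hij (k * t) := by
  induction k with
  | zero => ext r s; simp [elemGL]
  | succ k ih =>
    rw [pow_succ, ih]
    apply Units.ext
    rw [Units.val_mul]
    change (1 + single i j _) * (1 + single i j _) = 1 + single i j _
    rw [one_add_single_mul hij]
    push_cast
    congr 2
    ring

theorem X_pow_eq {i j : Fin g} (hij : i ≠ j) (d : ℕ) : X i j hij ^ d = diagHom g (elemGL hij d) := by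
  have : X i j hij = diagHom g (elemGL hij 1) := ofBlocks_eq_diagHom _ rfl
  rw [this, ← map_pow, elemGL_pow, mul_one]

theorem F_eq (i : Fin g) : F i = 1 - single i i 2 := by
  rw [F, S, if_pos rfl, smul_single]
  simp

theorem Z_eq (i : Fin g) : Z i = diagHom g ⟨F i, F i, F_mul_self i, F_mul_self i⟩ :=
  ofBlocks_eq_diagHom _ rfl

theorem isCongrOne_one_add_single {q t : ℤ} (h : q ∣ t) (i j : Fin g) :
    IsCongrOne q (1 + single i j t) := by
  obtain ⟨k, rfl⟩ := h
  exact ⟨single i j k, by rw [smul_single]; rfl⟩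

theorem X_pow_mem_level {i j : Fin g} (hij : i ≠ j) (d : ℕ) : X i j hij ^ d ∈ level g d := by
  rw [X_pow_eq, diagHom_apply, ofBlocks_mem_level_iff]
  refine ⟨isCongrOne_one_add_single dvd_rfl i j, by simp, ?_⟩
  change IsCongrOne _ (1 + single i j (-(d : ℤ)))ᵀ
  rw [transpose_add, transpose_one, transpose_single]
  exact isCongrOne_one_add_single (dvd_refl _).neg_right j i

theorem Y_pow_mem_level (i j : Fin g) (d : ℕ) : Y i j ^ d ∈ level g d := by
  change upper (S i j) (S_transpose i j) ^ d ∈ level g d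
  rw [upper_pow]
  refine ofBlocks_mem_level_iff.2 ⟨⟨0, by simp⟩, fun r s => ?_, ⟨0, by simp⟩⟩
  rw [Matrix.smul_apply, nsmul_eq_mul]
  exact dvd_mul_right _ _

theorem Z_mem_level (i : Fin g) : Z i ∈ level g 2 := by
  have : IsCongrOne ((2 : ℕ) : ℤ) (F i) := by
    rw [F_eq, sub_eq_add_neg, single_neg]
    exact isCongrOne_one_add_single (by norm_num) i i
  exact ofBlocks_mem_level_iff.2 ⟨this, by simp, this⟩

instance (g d : ℕ) : (level g d).Normal := by
  unfold level
  infer_instance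

theorem normalClosure_level_two (i : Fin g) :
    Subgroup.normalClosure ({Y i i ^ 2, Z i} : Set (urSp g)) = level g 2 := by
  refine le_antisymm (Subgroup.normalClosure_le_normal ?_) ?_
  · rintro x (rfl | rfl)
    exacts [Y_pow_mem_level _ _ _, Z_mem_level _]
  · set K := Subgroup.normalClosure ({Y i i ^ 2, Z i} : Set (urSp g)) with hK
    have hY : Y i i ^ 2 ∈ K := Subgroup.subset_normalClosure (Or.inl rfl)
    have hZ : Z i ∈ K := Subgroup.subset_normalClosure (Or.inr rfl)
    have hZ' : 1 - single i i 2 ∈ matrices (K.comap (diagHom g)) := by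
      rw [Z_eq] at hZ
      exact ⟨_, hZ, F_eq i⟩
    refine level_le hY fun A hA hAq => ?_
    refine mem_of_isCongrOne one_lt_two (fun k l hkl a b c d h ha hb hc _ => ?_)
      (fun _ => one_sub_single_mem_of_mem hZ') hA hAq
    exact block_mem_of_level_two
      (fun r s hrs => one_add_single_mul_mem hrs (one_add_single_two_mem hZ' hrs))
      (one_sub_single_mem_of_mem hZ') hkl h ha hb hc

theorem normalClosure_level (hg : 3 ≤ g) {d : ℕ} (hd : 3 ≤ d) {i j : Fin g} (hij : i ≠ j) :
    Subgroup.normalClosure ({X i j hij ^ d, Y i i ^ d} : Set (urSp g)) = level g d := by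
  refine le_antisymm (Subgroup.normalClosure_le_normal ?_) ?_
  · rintro x (rfl | rfl)
    exacts [X_pow_mem_level _ _, Y_pow_mem_level _ _ _]
  · set K := Subgroup.normalClosure ({X i j hij ^ d, Y i i ^ d} : Set (urSp g)) with hK
    have hX : X i j hij ^ d ∈ K := Subgroup.subset_normalClosure (Or.inl rfl)
    have hY : Y i i ^ d ∈ K := Subgroup.subset_normalClosure (Or.inr rfl)
    have hX' : 1 + single i j (d : ℤ) ∈ matrices (K.comap (diagHom g)) := by
      rw [X_pow_eq] at hX
      exact ⟨_, hX, rfl⟩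
    have hd0 : (d : ℤ) ≠ 0 := by omega
    refine level_le hY fun A hA hAq => ?_
    refine mem_of_isCongrOne (q := d) (by omega) (fun k l hkl a b c e h ha hb hc he => ?_)
      (fun h => ?_) hA hAq
    · exact block_mem_of_normal hd0 (by simpa using hg)
        (fun r s hrs => one_add_single_mul_mem hrs (one_add_single_mem_of_mem hij hX' hrs))
        hkl h ha hb hc he
    -- For d ≥ 3 sign matrices are not of level d, so none is needed.
    · have := Int.le_of_dvd two_pos h
      omega

end UrSp

/-- Indices are shifted by one: `Fin g` starts at `0`. -/
theorem mainTheorem5 :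
    (∀ (g : ℕ) (hg : 1 ≤ g),
      Subgroup.normalClosure
        ({UrSp.Y (⟨0, by omega⟩ : Fin g) ⟨0, by omega⟩ ^ 2, UrSp.Z (⟨0, by omega⟩ : Fin g)} :
          Set (UrSp.urSp g)) = UrSp.level g 2) ∧
    (∀ (g d : ℕ) (hg : 3 ≤ g) (_hd : 3 ≤ d),
      Subgroup.normalClosure
        ({UrSp.X (⟨0, by omega⟩ : Fin g) ⟨1, by omega⟩ (by simp) ^ d,
          UrSp.Y (⟨0, by omega⟩ : Fin g) ⟨0, by omega⟩ ^ d} :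
          Set (UrSp.urSp g)) = UrSp.level g d) :=
  ⟨fun _ _ => UrSp.normalClosure_level_two _,
    fun _ _ hg hd => UrSp.normalClosure_level hg hd (by simp)⟩
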